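/- Let $p_0\ge 0$, $q_0\ge 1$, and let $a_1,\dots,a_{p_0},b_1,\dots,b_{q_0}\in\mathbb R$ with $a_{p_0}\neq0$ (where $a_0:=1$) and $b_{q_0}\ne 0$; put $a_i=0$ for $i>p_0$ and $b_j=0$ for $j>q_0$. Consider on a probability space real random sequences satisfying $$y_{n+1}+\sum_{i=1}^{p_0}a_i y_{n+1-i}=\sum_{j=1}^{q_0}b_j u_{n+1-j}+w_{n+1},\qquad n\ge 0,$$ where $y_n=u_n=0$ for $n<0$ and the initial values $y_0,u_0$ are arbitrary random variables. The noise $(w_n)_{n\ge1}$ is i.i.d. $N(0,1)$, and $w_{n+1}$ is independent of $(y_0,u_0,\dots,u_n,w_1,\dots,w_n)$ for every $n\ge 0$. For a quantization step $\varepsilon>0$ let $s_n=\varepsilon\lfloor y_n/\varepsilon+\tfrac12\rfloor$ for $n\ge1$. For $p,q\ge 0$ let $$\psi_i(p,q)=[s_i,\dots,s_{i-p+1},u_i,\dots,u_{i-q+1}]^\top,$$ where in $\psi_i$ all entries $s_m,u_m$ with $m\le0$ are replaced by $0$, and let $\lambda^{(p,q)}_{\min}(n)$ and $\lambda^{(p,q)}_{\max}(n)$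 be the smallest and largest eigenvalues of $I+\sum_{i=0}^n\psi_i(p,q)\psi_i(p,q)^\top$. Define $$\theta_n(p,q)=\Big(I+\sum_{i=0}^{n-1}\psi_i\psi_i^\top\Big)^{-1}\sum_{i=0}^{n-1}\psi_i s_{i+1},\qquad \sigma_n(p,q)=\sum_{i=0}^{n-1}\big(s_{i+1}-\theta_n(p,q)^\top\psi_i(p,q)\big)^2,$$ with $\psi_i=\psi_i(p,q)$, and, for a real sequence $(l_n)$, $L_n(p,q)=\sigma_n(p,q)+l_n(p+q)$. Assume: 1. $(u_n)_{n\ge1}$ is i.i.d. uniform on $[-\delta,\delta]$ for some $\delta>0$. 2. $A(z)=1+a_1z+\dots+a_{p_0}z^{p_0}\neq0$ for all complex $|z|\le1$. 3. For some $c>0$: $|a_i|\le c$ for $1\le i\le p_0$, $|b_j|\le c$ for $1\le j\le q_0$, and $\varepsilon<\frac1{2(1+p_0c)}$. 4. $p_0\le p^*$ and $q_0\le q^*$ for known positive integers $p^*,q^*$. 5. For some $c_1>0$ and every $0\le p\le p^*$, almost surely $\lambda_{\min}^{(p,q^*)}(n)\ge c_1(n+1)$ for all sufficiently large $n$. For $p\le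 p_0$ let $\hat\theta_n(p)$ be $\theta_n(p,q^*)$ with $p_0-p$ zeros inserted after its first $p$ entries, and let $\tilde\theta_n(p)=[-a_1,\dots,-a_{p_0},b_1,\dots,b_{q^*}]^\top-\hat\theta_n(p)$. Then there are (deterministic) constants $c_3>0$ and $\gamma$ such that (i) almost surely $\lambda_{\max}^{(p_0,q^*)}(n)\le c_3(n+1)$ for all sufficiently large $n$; (ii) for every $p\le p_0$, almost surely $\|\tilde\theta_n(p)\|\le\gamma$ for all sufficiently large $n$. Moreover, let $c_3>0$ and $\gamma$ be any constants with (i) and (ii), let $\alpha_1>0$ and $0<\alpha_2<1$, and let $(l_n)$ satisfy, for all $n\ge1$, $$\big[5(1+p^*c)\varepsilon+\alpha_1\big]n\;\le\; l_n\;\le\;\frac{\alpha_2}{p^*}\Big[a_{p_0}^2c_1-2\gamma\sqrt{c_3(1+p^*c)\varepsilon}-3(1+p^*c)\varepsilon\Big]n .$$ Then every choice of $\hat p_n\in\operatorname{argmin}_{0\le p\le p^*}L_n(p,q^*)$ satisfies $\hat p_n\to p_0$ almost surely as $n\to\infty$. -/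

import Mathlib

open MeasureTheory ProbabilityTheory Filter Topology

noncomputable section

namespace QuantizedARX

/-- `delay x n k` is the lagged value `x_{n-k}`, with the convention `x_m = 0` for `m < 0`. -/
def delay (x : ℕ → ℝ) (n k : ℕ) : ℝ := if k ≤ n then x (n - k) else 0

/-- The uniform quantizer with step `ε`. -/
def quantize (ε y : ℝ) : ℝ := ε * (⌊y / ε + 1 / 2⌋ : ℝ)

/-- The data `x_1, x_2, …`, with the value at time `0` set to zero. -/
def fromOne (x : ℕ → ℝ) (n : ℕ) : ℝ := if n = 0 then 0 else x n

/-- Quantized outputs `s_n`, `n ≥ 1`, with `s_0 = 0`. -/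
def quantizedOutput (ε : ℝ) (y : ℕ → ℝ) : ℕ → ℝ := fromOne fun n => quantize ε (y n)

/-- `(y, u, w)` is a trajectory of `A(z) y_{n+1} = B(z) u_n + w_{n+1}`, `n ≥ 0`, where
`A(z) = 1 + a_1 z + ⋯ + a_{p₀} z^{p₀}`, `B(z) = b_1 + b_2 z + ⋯ + b_{q₀} z^{q₀-1}`, `z` is the
backward shift, and signals vanish at negative times. -/
def IsTrajectory (p₀ q₀ : ℕ) (a b : ℕ → ℝ) (y u w : ℕ → ℝ) : Prop :=
  ∀ n : ℕ, y (n + 1) + ∑ i ∈ Finset.Icc 1 p₀, a i * delay y (n + 1) i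
    = ∑ j ∈ Finset.Icc 1 q₀, b j * delay u (n + 1) j + w (n + 1)

/-- `ψ_i(p,q) = [s_i, …, s_{i-p+1}, u_i, …, u_{i-q+1}]ᵀ`. -/
def regressor (s u : ℕ → ℝ) (p q i : ℕ) : Fin p ⊕ Fin q → ℝ :=
  Sum.elim (fun k => delay s i k) (fun k => delay u i k)

/-- `P_n(p,q)⁻¹ = I + ∑_{i=0}^{n-1} ψ_i ψ_iᵀ`. -/
def infoMatrix (s u : ℕ → ℝ) (p q n : ℕ) : Matrix (Fin p ⊕ Fin q) (Fin p ⊕ Fin q) ℝ :=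
  1 + ∑ i ∈ Finset.range n, Matrix.vecMulVec (regressor s u p q i) (regressor s u p q i)

/-- Smallest eigenvalue of `I + ∑_{i=0}^{n} ψ_i ψ_iᵀ` (a symmetric matrix). -/
def lambdaMin (s u : ℕ → ℝ) (p q n : ℕ) : ℝ := sInf (spectrum ℝ (infoMatrix s u p q (n + 1)))

/-- Largest eigenvalue of `I + ∑_{i=0}^{n} ψ_i ψ_iᵀ` (a symmetric matrix). -/
def lambdaMax (s u : ℕ → ℝ) (p q n : ℕ) : ℝ := sSup (spectrum ℝ (infoMatrix s u p q (n + 1)))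

/-- `θ_n(p,q) = (I + ∑_{i<n} ψ_i ψ_iᵀ)⁻¹ ∑_{i<n} ψ_i s_{i+1}`. -/
def lsEstimate (s u : ℕ → ℝ) (p q n : ℕ) : Fin p ⊕ Fin q → ℝ :=
  Matrix.mulVec (infoMatrix s u p q n)⁻¹
    (∑ i ∈ Finset.range n, s (i + 1) • regressor s u p q i)

/-- Residual sum of squares `σ_n(p,q)`. -/
def residual (s u : ℕ → ℝ) (p q n : ℕ) : ℝ :=
  ∑ i ∈ Finset.range n, (s (i + 1) - lsEstimate s u p q n ⬝ᵥ regressor s u p q i) ^ 2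

/-- The criterion `L_n(p,q) = σ_n(p,q) + l_n (p + q)`. -/
def criterion (l : ℕ → ℝ) (s u : ℕ → ℝ) (p q n : ℕ) : ℝ :=
  residual s u p q n + l n * ((p : ℝ) + (q : ℝ))

/-- `[-a_1, …, -a_p, b_1, …, b_q]ᵀ`. -/
def trueParam (a b : ℕ → ℝ) (p q : ℕ) : Fin p ⊕ Fin q → ℝ :=
  Sum.elim (fun i => -a (i + 1)) (fun j => b (j + 1))

/-- The estimate `θ_n(p,q)` with its AR part padded by zeros (for `p ≤ p₀`) to length `p₀`. -/
def paddedEstimate (s u : ℕ → ℝ) (p₀ p q n : ℕ) : Fin p₀ ⊕ Fin q → ℝ :=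
  Sum.elim (fun i => if h : (i : ℕ) < p then lsEstimate s u p q n (Sum.inl ⟨i, h⟩) else 0)
    (fun j => lsEstimate s u p q n (Sum.inr j))

/-- Euclidean norm of the error `[-a_1, …, -a_{p₀}, b_1, …, b_q]ᵀ - paddedEstimate`. -/
def paramError (a b : ℕ → ℝ) (s u : ℕ → ℝ) (p₀ p q n : ℕ) : ℝ :=
  ‖WithLp.toLp 2 (trueParam a b p₀ q - paddedEstimate s u p₀ p q n)‖

/-- `c₃` bounds the largest eigenvalue: a.s., `λ_max^{(p₀,q)}(n) ≤ c₃ (n+1)` for all large `n`. -/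
def IsEigenBound {Ω : Type*} [MeasurableSpace Ω] (μ : Measure Ω) (S U : Ω → ℕ → ℝ)
    (p₀ q : ℕ) (c₃ : ℝ) : Prop :=
  0 < c₃ ∧ ∀ᵐ ω ∂μ, ∀ᶠ n : ℕ in atTop, lambdaMax (S ω) (U ω) p₀ q n ≤ c₃ * ((n : ℝ) + 1)

/-- `γ` bounds the parameter errors: for every `p ≤ p₀`, a.s., the error norm of the padded
estimate is at most `γ` for all large `n`. -/
def IsErrorBound {Ω : Type*} [MeasurableSpace Ω] (μ : Measure Ω) (a b : ℕ → ℝ)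
    (S U : Ω → ℕ → ℝ) (p₀ q : ℕ) (γ : ℝ) : Prop :=
  ∀ p ≤ p₀, ∀ᵐ ω ∂μ, ∀ᶠ n : ℕ in atTop, paramError a b (S ω) (U ω) p₀ p q n ≤ γ

end QuantizedARX

end

/-! With θ the true parameter, the data satisfy exactly s_{i+1} = θᵀψ_i + w_{i+1} + η_i, where η is
the `modelError`. Past a finite transient, η is a combination of rounding errors, so |η_i| ≤
(1+p₀c)ε/2. Since (1+p₀c)ε < 1/2, eventually ∑η² ≤ κn with κ = (1+p*c)ε.

Every residual is compared with E_n = ∑(w+η)². At p₀, optimality of regularized least squares gives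
σ_n ≤ E_n + o(n). For other p, let d be the estimation error, padded by zeros if p < p₀. Then σ_n =
∑(dᵀψ + w + η)², and everything rests on 2∑(dᵀψ)w being o(n). If p > p₀, what remains is ∑(dᵀψ+η)² −
∑η² ≥ −κn. Overfitting therefore gains at most about κn, less than the extra penalty l_n ≥ 5κn. If p
< p₀, the last AR entry of d is −a_{p₀}, so excitation gives ∑(dᵀψ)² ≥ a_{p₀}²c₁n − o(n).
Cauchy–Schwarz bounds the cross term with η by γ√(c₃κ)n. The loss exceeds the penalty saved, which
is at most p* l_n.

The noise term is handled in two steps. `tendsto_avg_mul_noise`, a martingale law of large numbers,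
gives ∑ψ_{i,k}w_{i+1} = o(n) for each coordinate k. Boundedness of d then permits summing over
coordinates (`eventually_abs_sum_dotProduct_le`), although d depends on the whole path. Both steps
need ∑s² = O(n), which is ℓ² stability of A (`exists_energy_bound`) plus the strong law for w². This
energy bound also supplies c₃ and, with excitation, γ. -/

namespace QuantizedARX

/-! ### Regularized least squares and spectral bounds for the Gram matrix -/

section Ridge

open Matrix

/-- The regularized Gram matrix `I + ∑_{i<n} ψ_i ψ_iᵀ`. -/
def gram {ι : Type*} [DecidableEq ι] (ψ : ℕ → ι → ℝ) (n : ℕ) : Matrix ι ι ℝ :=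
  1 + ∑ i ∈ Finset.range n, vecMulVec (ψ i) (ψ i)

theorem gram_isHermitian {ι : Type*} [DecidableEq ι] (ψ : ℕ → ι → ℝ) (n : ℕ) :
    (gram ψ n).IsHermitian := by
  unfold gram
  rw [IsHermitian, conjTranspose_add, conjTranspose_one, conjTranspose_sum]
  congr 1
  refine Finset.sum_congr rfl fun i _ => ?_
  ext j k
  simp [vecMulVec_apply, mul_comm]

variable {ι : Type*} [Fintype ι]

theorem dotProduct_self_nonneg' (x : ι → ℝ) : 0 ≤ x ⬝ᵥ x :=
  Finset.sum_nonneg fun i _ => mul_self_nonneg (x i)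

theorem dotProduct_sq_le (x z : ι → ℝ) : (x ⬝ᵥ z) ^ 2 ≤ (x ⬝ᵥ x) * (z ⬝ᵥ z) := by
  simpa only [dotProduct, sq] using Finset.sum_mul_sq_le_sq_mul_sq Finset.univ x z

variable [DecidableEq ι]

theorem dotProduct_gram_mulVec (ψ : ℕ → ι → ℝ) (n : ℕ) (x z : ι → ℝ) :
    x ⬝ᵥ gram ψ n *ᵥ z = x ⬝ᵥ z + ∑ i ∈ Finset.range n, (x ⬝ᵥ ψ i) * (z ⬝ᵥ ψ i) := by
  unfold gram
  rw [add_mulVec, one_mulVec, dotProduct_add, sum_mulVec, dotProduct_sum]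
  congr 1
  refine Finset.sum_congr rfl fun i _ => ?_
  rw [vecMulVec_mulVec, dotProduct_comm z (ψ i)]
  simp [dotProduct_smul, mul_comm]

theorem gram_quadForm (ψ : ℕ → ι → ℝ) (n : ℕ) (x : ι → ℝ) :
    x ⬝ᵥ gram ψ n *ᵥ x = x ⬝ᵥ x + ∑ i ∈ Finset.range n, (x ⬝ᵥ ψ i) ^ 2 := by
  simp only [dotProduct_gram_mulVec, sq]

theorem gram_isUnit_det (ψ : ℕ → ι → ℝ) (n : ℕ) : IsUnit (gram ψ n).det := by
  rw [← isUnit_iff_isUnit_det]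
  refine (PosDef.of_dotProduct_mulVec_pos (gram_isHermitian ψ n) fun x hx => ?_).isUnit
  rw [star_trivial, gram_quadForm]
  have h1 : 0 < x ⬝ᵥ x :=
    lt_of_le_of_ne (dotProduct_self_nonneg' x) fun h => hx (dotProduct_self_eq_zero.1 h.symm)
  have h2 : 0 ≤ ∑ i ∈ Finset.range n, (x ⬝ᵥ ψ i) ^ 2 := Finset.sum_nonneg fun i _ => sq_nonneg _
  linarith

theorem sInf_spectrum_mul_le {M : Matrix ι ι ℝ} (hM : M.IsHermitian) (x : ι → ℝ) :
    sInf (spectrum ℝ M) * (x ⬝ᵥ x) ≤ x ⬝ᵥ M *ᵥ x := by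
  set r := sInf (spectrum ℝ M) with hr
  have hpsd : (M - algebraMap ℝ (Matrix ι ι ℝ) r).PosSemidef := by
    rw [posSemidef_iff_isHermitian_and_spectrum_nonneg]
    refine ⟨hM.sub ?_, ?_⟩
    · rw [algebraMap_eq_diagonal]
      exact isHermitian_diagonal _
    · rw [← spectrum.sub_singleton_eq]
      rintro _ ⟨t, ht, _, rfl, rfl⟩
      exact sub_nonneg.2 (csInf_le finite_real_spectrum.bddBelow ht)
  have := hpsd.dotProduct_mulVec_nonneg x
  rw [star_trivial, sub_mulVec, dotProduct_sub, Algebra.algebraMap_eq_smul_one, smul_mulVec, one_mulVec,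
    dotProduct_smul, smul_eq_mul] at this
  linarith

theorem le_sSup_spectrum_mul {M : Matrix ι ι ℝ} (hM : M.IsHermitian) (x : ι → ℝ) :
    x ⬝ᵥ M *ᵥ x ≤ sSup (spectrum ℝ M) * (x ⬝ᵥ x) := by
  set r := sSup (spectrum ℝ M) with hr
  have hpsd : (algebraMap ℝ (Matrix ι ι ℝ) r - M).PosSemidef := by
    rw [posSemidef_iff_isHermitian_and_spectrum_nonneg]
    refine ⟨IsHermitian.sub ?_ hM, ?_⟩
    · rw [algebraMap_eq_diagonal]
      exact isHermitian_diagonal _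
    · rw [← spectrum.singleton_sub_eq]
      rintro _ ⟨_, rfl, t, ht, rfl⟩
      exact sub_nonneg.2 (le_csSup finite_real_spectrum.bddAbove ht)
  have := hpsd.dotProduct_mulVec_nonneg x
  rw [star_trivial, sub_mulVec, dotProduct_sub, Algebra.algebraMap_eq_smul_one, smul_mulVec, one_mulVec,
    dotProduct_smul, smul_eq_mul] at this
  linarith

/-- Evaluate the form at an eigenvector. `0 ≤ B` covers an empty spectrum, whose `sSup` is 0. -/
theorem sSup_spectrum_le {M : Matrix ι ι ℝ} {B : ℝ} (hB : 0 ≤ B)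
    (h : ∀ x : ι → ℝ, x ⬝ᵥ M *ᵥ x ≤ B * (x ⬝ᵥ x)) : sSup (spectrum ℝ M) ≤ B := by
  refine Real.sSup_le (fun t ht => ?_) hB
  rw [← spectrum_toLin', ← Module.End.hasEigenvalue_iff_mem_spectrum] at ht
  obtain ⟨v, hv⟩ := ht.exists_hasEigenvector
  have hpos : 0 < v ⬝ᵥ v :=
    lt_of_le_of_ne (dotProduct_self_nonneg' v) fun h => hv.2 (dotProduct_self_eq_zero.1 h.symm)
  have h1 := h v
  rw [← toLin'_apply, hv.apply_eq_smul, dotProduct_smul, smul_eq_mul] at h1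
  exact le_of_mul_le_mul_right h1 hpos

theorem gram_quadForm_le (ψ : ℕ → ι → ℝ) (n : ℕ) (x : ι → ℝ) :
    x ⬝ᵥ gram ψ n *ᵥ x ≤ (1 + ∑ i ∈ Finset.range n, ψ i ⬝ᵥ ψ i) * (x ⬝ᵥ x) := by
  rw [gram_quadForm, add_mul, one_mul, Finset.sum_mul]
  gcongr with i _
  rw [mul_comm]
  exact dotProduct_sq_le _ _

/-- The regularized least squares estimate of `t` from the regressors `ψ`. -/
noncomputable def ridge (ψ : ℕ → ι → ℝ) (t : ℕ → ℝ) (n : ℕ) : ι → ℝ :=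
  (gram ψ n)⁻¹ *ᵥ ∑ i ∈ Finset.range n, t i • ψ i

theorem gram_mulVec_ridge (ψ : ℕ → ι → ℝ) (t : ℕ → ℝ) (n : ℕ) :
    gram ψ n *ᵥ ridge ψ t n = ∑ i ∈ Finset.range n, t i • ψ i := by
  rw [ridge, mulVec_mulVec, mul_nonsing_inv _ (gram_isUnit_det ψ n), one_mulVec]

theorem ridge_normal_eq (ψ : ℕ → ι → ℝ) (t : ℕ → ℝ) (n : ℕ) (x : ι → ℝ) :
    x ⬝ᵥ ridge ψ t n + ∑ i ∈ Finset.range n, (x ⬝ᵥ ψ i) * (ridge ψ t n ⬝ᵥ ψ i)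
      = ∑ i ∈ Finset.range n, t i * (x ⬝ᵥ ψ i) := by
  rw [← dotProduct_gram_mulVec, gram_mulVec_ridge, dotProduct_sum]
  simp [dotProduct_smul]

/-- The estimate minimizes squared error plus squared norm: completing the square around it leaves
only nonnegative terms. Its own penalty is then dropped. -/
theorem ridge_le (ψ : ℕ → ι → ℝ) (t : ℕ → ℝ) (n : ℕ) (x : ι → ℝ) :
    ∑ i ∈ Finset.range n, (t i - ridge ψ t n ⬝ᵥ ψ i) ^ 2
      ≤ ∑ i ∈ Finset.range n, (t i - x ⬝ᵥ ψ i) ^ 2 + x ⬝ᵥ x := by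
  set θ := ridge ψ t n with hθ
  have h1 := ridge_normal_eq ψ t n (x - θ)
  rw [← hθ] at h1
  have h2 : ∑ i ∈ Finset.range n, (t i - x ⬝ᵥ ψ i) ^ 2
      = ∑ i ∈ Finset.range n, (t i - θ ⬝ᵥ ψ i) ^ 2
        + ∑ i ∈ Finset.range n, ((x - θ) ⬝ᵥ ψ i) ^ 2
        + 2 * (∑ i ∈ Finset.range n, ((x - θ) ⬝ᵥ ψ i) * (θ ⬝ᵥ ψ i)
          - ∑ i ∈ Finset.range n, t i * ((x - θ) ⬝ᵥ ψ i)) := by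
    rw [← Finset.sum_sub_distrib, Finset.mul_sum, ← Finset.sum_add_distrib,
      ← Finset.sum_add_distrib]
    refine Finset.sum_congr rfl fun i _ => ?_
    rw [sub_dotProduct]
    ring
  have h3 : 0 ≤ ∑ i ∈ Finset.range n, ((x - θ) ⬝ᵥ ψ i) ^ 2 :=
    Finset.sum_nonneg fun i _ => sq_nonneg _
  have h4 := dotProduct_self_nonneg' (x - θ)
  have h5 := dotProduct_self_nonneg' θ
  have h6 : x ⬝ᵥ x = (x - θ) ⬝ᵥ (x - θ) + 2 * ((x - θ) ⬝ᵥ θ) + θ ⬝ᵥ θ := by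
    simp only [sub_dotProduct, dotProduct_sub, dotProduct_comm θ x]
    ring
  linarith

/-- Test the normal equations with the estimate itself and use that its residual is nonnegative.
Combined with excitation, this keeps the estimate bounded. -/
theorem ridge_quadForm_le (ψ : ℕ → ι → ℝ) (t : ℕ → ℝ) (n : ℕ) :
    ridge ψ t n ⬝ᵥ gram ψ n *ᵥ ridge ψ t n ≤ ∑ i ∈ Finset.range n, t i ^ 2 := by
  set θ := ridge ψ t n with hθ
  have h1 := ridge_normal_eq ψ t n θ
  rw [← hθ] at h1
  have h2 : 0 ≤ ∑ i ∈ Finset.range n, (t i - θ ⬝ᵥ ψ i) ^ 2 :=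
    Finset.sum_nonneg fun i _ => sq_nonneg _
  have h3 : ∑ i ∈ Finset.range n, (t i - θ ⬝ᵥ ψ i) ^ 2 = ∑ i ∈ Finset.range n, t i ^ 2
      - 2 * ∑ i ∈ Finset.range n, t i * (θ ⬝ᵥ ψ i)
      + ∑ i ∈ Finset.range n, (θ ⬝ᵥ ψ i) * (θ ⬝ᵥ ψ i) := by
    rw [Finset.mul_sum, ← Finset.sum_sub_distrib, ← Finset.sum_add_distrib]
    refine Finset.sum_congr rfl fun i _ => ?_
    ring
  have h5 := dotProduct_self_nonneg' θ
  rw [dotProduct_gram_mulVec]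
  linarith

end Ridge

/-! ### ℓ² stability of the autoregressive recursion -/

section Stability

open Polynomial

/-- Comparing coefficients, zY_{i+1} = Y_i − V_{i+1}. As |z| > 1, the energy of the shifted Y is
absorbed on the left after summing. -/
theorem energy_bound_of_X_sub_C {z : ℂ} (hz : 1 < ‖z‖) (Y V : PowerSeries ℂ)
    (h : Y * ((X - C z : ℂ[X]) : PowerSeries ℂ) = V) (n : ℕ) :
    ∑ i ∈ Finset.range n, ‖PowerSeries.coeff i Y‖ ^ 2
      ≤ ((‖z‖ - 1) ^ 2)⁻¹ * ∑ i ∈ Finset.range n, ‖PowerSeries.coeff i V‖ ^ 2 := by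
  set ρ := ‖z‖ with hρ
  set f : ℕ → ℝ := fun i => ‖PowerSeries.coeff i Y‖ ^ 2 with hf
  set g : ℕ → ℝ := fun i => ‖PowerSeries.coeff i V‖ ^ 2 with hg
  have hρ1 : 0 < ρ - 1 := by linarith
  -- Young's inequality (B+D)² ≤ ρ(B² + D²/(ρ−1)), weighted so that B² ends with a coefficient
  -- smaller by the factor ρ than that of A². Summation then gives the gain (ρ−1)⁻².
  have key : ∀ A B D : ℝ, 0 ≤ A → 0 ≤ B → 0 ≤ D → ρ * A ≤ B + D →
      ρ * A ^ 2 * (ρ - 1) ≤ B ^ 2 * (ρ - 1) + D ^ 2 := by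
    intro A B D hA hB hD hle
    have h1 : (ρ * A) ^ 2 ≤ (B + D) ^ 2 := by gcongr
    have h2 : (B + D) ^ 2 * (ρ - 1) ≤ ρ * (B ^ 2 * (ρ - 1) + D ^ 2) := by
      nlinarith [sq_nonneg ((ρ - 1) * B - D)]
    have h3 : ρ * (ρ * A ^ 2 * (ρ - 1)) ≤ ρ * (B ^ 2 * (ρ - 1) + D ^ 2) := by
      nlinarith [mul_le_mul_of_nonneg_right h1 hρ1.le]
    exact le_of_mul_le_mul_left h3 (by linarith)
  have h0 : ρ * f 0 * (ρ - 1) ≤ g 0 := by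
    have h1 : V.coeff 0 = - (z * PowerSeries.coeff 0 Y) := by
      rw [← h]
      simp [mul_comm]
    have := key ‖PowerSeries.coeff 0 Y‖ 0 ‖PowerSeries.coeff 0 V‖ (norm_nonneg _) le_rfl
      (norm_nonneg _) (by rw [h1, norm_neg, norm_mul, zero_add])
    simpa [hf, hg] using this
  have hs : ∀ i, ρ * f (i + 1) * (ρ - 1) ≤ f i * (ρ - 1) + g (i + 1) := by
    intro i
    have h1 : z * PowerSeries.coeff (i + 1) Y
        = PowerSeries.coeff i Y - PowerSeries.coeff (i + 1) V := by
      rw [← h]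
      simp [mul_sub, PowerSeries.coeff_succ_mul_X, mul_comm]
    refine key _ _ _ (norm_nonneg _) (norm_nonneg _) (norm_nonneg _) ?_
    rw [hρ, ← norm_mul, h1]
    exact norm_sub_le _ _
  have hsum : ∀ n, ρ * (∑ i ∈ Finset.range n, f i) * (ρ - 1)
      ≤ (∑ i ∈ Finset.range n, f i) * (ρ - 1) + ∑ i ∈ Finset.range n, g i := by
    have : ∀ n, ρ * (∑ i ∈ Finset.range (n + 1), f i) * (ρ - 1)
      ≤ (∑ i ∈ Finset.range n, f i) * (ρ - 1) + ∑ i ∈ Finset.range (n + 1), g i := by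
      intro n
      induction n with
      | zero => simpa using h0
      | succ k ih =>
        rw [Finset.sum_range_succ f, Finset.sum_range_succ g, Finset.sum_range_succ f k]
        rw [Finset.sum_range_succ f k] at ih
        linarith [hs k]
    intro n
    cases n with
    | zero => simp
    | succ k =>
      refine (this k).trans ?_
      rw [Finset.sum_range_succ f]
      nlinarith [sq_nonneg ‖PowerSeries.coeff k Y‖,
        mul_nonneg (sq_nonneg ‖PowerSeries.coeff k Y‖) hρ1.le]
  rw [inv_mul_eq_div, le_div_iff₀ (by positivity)]
  nlinarith [hsum n]

/-- Peel off one root at a time; the gains multiply. -/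
theorem energy_bound_of_prod (R : Multiset ℂ) (hR : ∀ z ∈ R, 1 < ‖z‖) :
    ∃ K : ℝ, 0 ≤ K ∧ ∀ Y V : PowerSeries ℂ,
      Y * (((R.map fun z => X - C z).prod : ℂ[X]) : PowerSeries ℂ) = V → ∀ n,
      ∑ i ∈ Finset.range n, ‖PowerSeries.coeff i Y‖ ^ 2
        ≤ K * ∑ i ∈ Finset.range n, ‖PowerSeries.coeff i V‖ ^ 2 := by
  induction R using Multiset.induction_on with
  | empty =>
    refine ⟨1, zero_le_one, fun Y V h n => ?_⟩
    have : Y = V := by simpa using h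
    rw [this, one_mul]
  | cons z R ih =>
    obtain ⟨K, hK, H⟩ := ih fun x hx => hR x (Multiset.mem_cons_of_mem hx)
    refine ⟨((‖z‖ - 1) ^ 2)⁻¹ * K, by positivity, fun Y V h n => ?_⟩
    rw [Multiset.map_cons, Multiset.prod_cons, coe_mul, ← mul_assoc] at h
    refine (energy_bound_of_X_sub_C (hR z (Multiset.mem_cons_self z R)) Y _ rfl n).trans ?_
    rw [mul_assoc]
    exact mul_le_mul_of_nonneg_left (H _ _ h n) (by positivity)

theorem energy_bound_of_polynomial (A : ℂ[X]) (hA : ∀ z : ℂ, ‖z‖ ≤ 1 → A.eval z ≠ 0) :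
    ∃ K : ℝ, 0 ≤ K ∧ ∀ Y V : PowerSeries ℂ, Y * (A : PowerSeries ℂ) = V → ∀ n,
      ∑ i ∈ Finset.range n, ‖PowerSeries.coeff i Y‖ ^ 2
        ≤ K * ∑ i ∈ Finset.range n, ‖PowerSeries.coeff i V‖ ^ 2 := by
  have hA0 : A ≠ 0 := fun h => hA 0 (by simp) (by simp [h])
  have hlc : A.leadingCoeff ≠ 0 := leadingCoeff_ne_zero.2 hA0
  have hR : ∀ z ∈ A.roots, 1 < ‖z‖ := by
    intro z hz
    by_contra! hle
    exact hA z hle (isRoot_of_mem_roots hz)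
  obtain ⟨K, hK, H⟩ := energy_bound_of_prod A.roots hR
  refine ⟨K * (‖A.leadingCoeff‖ ^ 2)⁻¹, by positivity, fun Y V h n => ?_⟩
  rw [(IsAlgClosed.splits A).eq_prod_roots, coe_mul, mul_left_comm, coe_C] at h
  have h2 := H Y _ rfl n
  have h3 : ∀ i, ‖PowerSeries.coeff i V‖ ^ 2 = ‖A.leadingCoeff‖ ^ 2 *
      ‖PowerSeries.coeff i (Y * (((A.roots.map fun z => X - C z).prod : ℂ[X]) :
        PowerSeries ℂ))‖ ^ 2 := by
    intro i
    rw [← h, PowerSeries.coeff_C_mul, norm_mul, mul_pow]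
  refine h2.trans (le_of_eq ?_)
  simp only [h3, ← Finset.mul_sum]
  field_simp

/-- `ℓ²` stability of `A(z) y = v` when `A` has no zeros in the closed unit disc. -/
theorem exists_energy_bound (p₀ : ℕ) (a : ℕ → ℝ) (ha_zero : a 0 = 1)
    (hstable : ∀ z : ℂ, ‖z‖ ≤ 1 → ∑ i ∈ Finset.range (p₀ + 1), (a i : ℂ) * z ^ i ≠ 0) :
    ∃ K : ℝ, 0 ≤ K ∧ ∀ y v : ℕ → ℝ, y 0 = v 0 →
      (∀ n, y (n + 1) + ∑ i ∈ Finset.Icc 1 p₀, a i * delay y (n + 1) i = v (n + 1)) →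
      ∀ n, ∑ i ∈ Finset.range n, y i ^ 2 ≤ K * ∑ i ∈ Finset.range n, v i ^ 2 := by
  set A : ℂ[X] := ∑ i ∈ Finset.range (p₀ + 1), C (a i : ℂ) * X ^ i with hAdef
  obtain ⟨K, hK, H⟩ := energy_bound_of_polynomial A (fun z hz => by
    simpa [hAdef, eval_finsetSum] using hstable z hz)
  refine ⟨K, hK, fun y v h0 h n => ?_⟩
  have hcoef : ∀ m, y m + ∑ i ∈ Finset.Icc 1 p₀, a i * delay y m i = v m := by
    intro m
    cases m with
    | zero =>
      rw [Finset.sum_eq_zero, add_zero, h0]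
      intro i hi
      have : ¬ i ≤ 0 := by have := (Finset.mem_Icc.1 hi).1; omega
      simp [delay, this]
    | succ m => exact h m
  -- Multiplying by X^i shifts coefficients and fills with zeros, which is `delay`; the recursion
  -- with zero past is thus one identity of power series.
  have key := H (PowerSeries.mk fun i => (y i : ℂ)) (PowerSeries.mk fun i => (v i : ℂ)) (by
    ext m
    rw [PowerSeries.coeff_mk, ← hcoef m, hAdef]
    have hc : ((∑ i ∈ Finset.range (p₀ + 1), C (a i : ℂ) * X ^ i : ℂ[X]) : PowerSeries ℂ)
        = ∑ i ∈ Finset.range (p₀ + 1), PowerSeries.C (a i : ℂ) * PowerSeries.X ^ i := by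
      rw [← coeToPowerSeries.ringHom_apply, map_sum]
      simp
    rw [hc, Finset.mul_sum, map_sum, Finset.range_eq_Ico, Finset.sum_eq_sum_Ico_succ_bot (by omega)]
    have hcm : ∀ i, PowerSeries.coeff m ((PowerSeries.mk fun i => (y i : ℂ))
        * (PowerSeries.C (a i : ℂ) * PowerSeries.X ^ i)) = ((a i * delay y m i : ℝ) : ℂ) := by
      intro i
      rw [mul_left_comm, PowerSeries.coeff_C_mul, PowerSeries.coeff_mul_X_pow', delay]
      split_ifs <;> simp
    simp only [hcm]
    have : Finset.Ico (0 + 1) (p₀ + 1) = Finset.Icc 1 p₀ := by ext i; simp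
    rw [this, ha_zero]
    simp [delay]) n
  simpa using key

end Stability

/-! ### A law of large numbers for martingale transforms -/

section MartingaleLLN

/-- Kronecker's lemma for the weights `1 / (n + 1)`. -/
theorem tendsto_avg_of_tendsto_sum_div {x : ℕ → ℝ} {m : ℝ}
    (h : Tendsto (fun n => ∑ i ∈ Finset.range n, x i / ((i : ℝ) + 1)) atTop (𝓝 m)) :
    Tendsto (fun n : ℕ => (∑ i ∈ Finset.range n, x i) / n) atTop (𝓝 0) := by
  set M : ℕ → ℝ := fun n => ∑ i ∈ Finset.range n, x i / ((i : ℝ) + 1) with hM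
  -- Abel summation: the average is M_n minus the Cesàro mean of M, and both tend to m.
  have habel : ∀ n : ℕ, ∑ i ∈ Finset.range n, x i = n * M n - ∑ i ∈ Finset.range n, M i := by
    intro n
    induction n with
    | zero => simp
    | succ k ih =>
      have h1 : M (k + 1) = M k + x k / ((k : ℝ) + 1) := by simp [hM, Finset.sum_range_succ]
      have h2 : ((k : ℝ) + 1) ≠ 0 := by positivity
      rw [Finset.sum_range_succ, ih, Finset.sum_range_succ M, h1]
      push_cast
      field_simp
      ring
  have h0 := h.sub h.cesaro
  rw [sub_self] at h0
  refine h0.congr' ?_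
  filter_upwards [eventually_ge_atTop 1] with n hn
  have : (n : ℝ) ≠ 0 := by positivity
  rw [habel]
  field_simp

/-- Domination of partial sums survives decreasing weights. The induction carries the surplus Kn −
∑d at the current weight. -/
theorem weighted_sum_le {d : ℕ → ℝ} {K : ℝ}
    (hT : ∀ n : ℕ, ∑ k ∈ Finset.range n, d k ≤ K * n) (n : ℕ) :
    ∑ k ∈ Finset.range n, d k / ((k : ℝ) + 1) ^ 2
      ≤ ∑ k ∈ Finset.range n, K / ((k : ℝ) + 1) ^ 2 := by
  have key : ∑ k ∈ Finset.range n, d k / ((k : ℝ) + 1) ^ 2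
      + (K * n - ∑ k ∈ Finset.range n, d k) / ((n : ℝ) + 1) ^ 2
      ≤ ∑ k ∈ Finset.range n, K / ((k : ℝ) + 1) ^ 2 := by
    induction n with
    | zero => simp
    | succ k ih =>
      have h1 : (K * ((k + 1 : ℕ) : ℝ) - ∑ j ∈ Finset.range (k + 1), d j)
          / (((k + 1 : ℕ) : ℝ) + 1) ^ 2
          ≤ (K * ((k + 1 : ℕ) : ℝ) - ∑ j ∈ Finset.range (k + 1), d j) / ((k : ℝ) + 1) ^ 2 := by
        apply div_le_div_of_nonneg_left
        · linarith [hT (k + 1)]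
        · positivity
        · push_cast
          gcongr
          linarith
      have h2 : (K * ((k + 1 : ℕ) : ℝ) - ∑ j ∈ Finset.range (k + 1), d j) / ((k : ℝ) + 1) ^ 2
          = (K * k - ∑ j ∈ Finset.range k, d j) / ((k : ℝ) + 1) ^ 2 + K / ((k : ℝ) + 1) ^ 2
            - d k / ((k : ℝ) + 1) ^ 2 := by
        rw [Finset.sum_range_succ]
        push_cast
        ring
      rw [Finset.sum_range_succ, Finset.sum_range_succ (fun k : ℕ => K / ((k : ℝ) + 1) ^ 2)]
      linarith
  have : 0 ≤ (K * n - ∑ k ∈ Finset.range n, d k) / ((n : ℝ) + 1) ^ 2 :=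
    div_nonneg (by linarith [hT n]) (by positivity)
  linarith

variable {Ω : Type*} {m0 : MeasurableSpace Ω} {μ : Measure Ω} [IsProbabilityMeasure μ]

/-- A martingale transform of a centred noise with bounded total weight converges. -/
theorem exists_tendsto_sum_mul_of_bdd (ℱ : Filtration ℕ m0) (φ W : ℕ → Ω → ℝ)
    (hφ : ∀ i, Measurable[ℱ i] (φ i)) (hW : ∀ i, Measurable[ℱ (i + 1)] (W i))
    (hind : ∀ i, Indep (ℱ i) (MeasurableSpace.comap (W i) inferInstance) μ)
    (hW2 : ∀ i, MemLp (W i) 2 μ) (hmean : ∀ i, ∫ ω, W i ω ∂μ = 0)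
    (hvar : ∀ i, ∫ ω, W i ω ^ 2 ∂μ = 1)
    (hbdd : ∀ i, ∃ C, ∀ ω, |φ i ω| ≤ C)
    {B : ℝ} (hB : ∀ n ω, ∑ i ∈ Finset.range n, φ i ω ^ 2 ≤ B) :
    ∀ᵐ ω ∂μ, ∃ m, Tendsto (fun n => ∑ i ∈ Finset.range n, φ i ω * W i ω) atTop (𝓝 m) := by
  have hφm : ∀ i, Measurable (φ i) := fun i => (hφ i).mono (ℱ.le i) le_rfl
  have hWm : ∀ i, Measurable (W i) := fun i => (hW i).mono (ℱ.le _) le_rfl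
  set M : ℕ → Ω → ℝ := fun n ω => ∑ i ∈ Finset.range n, φ i ω * W i ω with hM
  have hMsucc : ∀ n, M (n + 1) = fun ω => M n ω + φ n ω * W n ω := by
    intro n
    ext ω
    simp [hM, Finset.sum_range_succ]
  have hMF : ∀ n, Measurable[ℱ n] (M n) := by
    intro n
    refine Finset.measurable_sum _ fun i hi => ?_
    have hi' := Finset.mem_range.1 hi
    exact ((hφ i).mono (ℱ.mono hi'.le) le_rfl).mul ((hW i).mono (ℱ.mono hi') le_rfl)
  have hφL : ∀ i, MemLp (φ i) ⊤ μ := by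
    intro i
    obtain ⟨C, hC⟩ := hbdd i
    exact memLp_top_of_bound (hφm i).aestronglyMeasurable C (Eventually.of_forall hC)
  have hprod : ∀ i, MemLp (fun ω => φ i ω * W i ω) 2 μ := fun i => (hW2 i).mul (hφL i)
  have hM2 : ∀ n, MemLp (M n) 2 μ := fun n => memLp_finsetSum _ fun i _ => hprod i
  have hindep : ∀ n (f : Ω → ℝ), Measurable[ℱ n] f → ∀ g : ℝ → ℝ, Measurable g →
      IndepFun f (g ∘ W n) μ := by
    intro n f hf g hg
    have h1 : IndepFun f (W n) μ := by
      rw [IndepFun_iff_Indep]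
      exact indep_of_indep_of_le_left (hind n) (measurable_iff_comap_le.1 hf)
    exact h1.comp measurable_id hg
  -- M_n φ_n is ℱ_n-measurable and W_n is centred and independent of ℱ_n, so increments are
  -- orthogonal and E M_n² = ∑ E φ_i² ≤ B.
  have hcross : ∀ n, ∫ ω, M n ω * (φ n ω * W n ω) ∂μ = 0 := by
    intro n
    have h1 := (hindep n _ ((hMF n).mul (hφ n)) id measurable_id).integral_mul_eq_mul_integral
      (((hM2 n).1).mul (hφm n).aestronglyMeasurable) (hWm n).aestronglyMeasurable
    have h2 : ∫ x, (id ∘ W n) x ∂μ = 0 := hmean n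
    rw [h2, mul_zero] at h1
    rw [← h1]
    refine integral_congr_ae (Eventually.of_forall fun ω => ?_)
    simp [mul_assoc]
  have hsq : ∀ n, ∫ ω, (φ n ω * W n ω) ^ 2 ∂μ = ∫ ω, φ n ω ^ 2 ∂μ := by
    intro n
    have h1 := (hindep n _ ((hφ n).pow_const 2) (fun x => x ^ 2)
      (measurable_id.pow_const 2)).integral_mul_eq_mul_integral
      ((hφm n).pow_const 2).aestronglyMeasurable ((hWm n).pow_const 2).aestronglyMeasurable
    have h2 : ∫ x, ((fun x : ℝ => x ^ 2) ∘ W n) x ∂μ = 1 := hvar n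
    rw [h2, mul_one] at h1
    rw [← h1]
    refine integral_congr_ae (Eventually.of_forall fun ω => ?_)
    simp [mul_pow]
  have hφsq : ∀ n, Integrable (fun ω => φ n ω ^ 2) μ :=
    fun n => ((hφL n).mono_exponent le_top : MemLp (φ n) 2 μ).integrable_sq
  have hEM : ∀ n, ∫ ω, M n ω ^ 2 ∂μ = ∑ i ∈ Finset.range n, ∫ ω, φ i ω ^ 2 ∂μ := by
    intro n
    induction n with
    | zero => simp [hM]
    | succ k ih =>
      rw [Finset.sum_range_succ, ← ih, ← hsq k]
      have hi1 : Integrable (fun ω => M k ω ^ 2) μ := (hM2 k).integrable_sq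
      have hi2 : Integrable (fun ω => M k ω * (φ k ω * W k ω)) μ := (hM2 k).integrable_mul (hprod k)
      have hi3 : Integrable (fun ω => (φ k ω * W k ω) ^ 2) μ := (hprod k).integrable_sq
      have he : (fun ω => M (k + 1) ω ^ 2) = fun ω =>
          (M k ω ^ 2 + 2 * (M k ω * (φ k ω * W k ω))) + (φ k ω * W k ω) ^ 2 := by
        ext ω
        rw [hMsucc]
        ring
      have hi4 : Integrable (fun ω => M k ω ^ 2 + 2 * (M k ω * (φ k ω * W k ω))) μ :=
        hi1.add (hi2.const_mul 2)
      rw [he, integral_add hi4 hi3, integral_add hi1 (hi2.const_mul 2),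
        integral_const_mul, hcross k]
      ring
  have hEMB : ∀ n, ∫ ω, M n ω ^ 2 ∂μ ≤ B := by
    intro n
    rw [hEM, ← integral_finsetSum _ fun i _ => hφsq i]
    calc _ ≤ ∫ _ : Ω, B ∂μ := integral_mono (integrable_finsetSum _ fun i _ => hφsq i)
            (integrable_const _) (hB n)
      _ = B := by simp
  -- |x| ≤ 1 + x² converts the second-moment bound into the L¹ bound required for almost sure
  -- convergence.
  have hL1 : ∀ n, eLpNorm (M n) 1 μ ≤ ((1 + B).toNNReal : ENNReal) := by
    intro n
    have hi : Integrable (M n) μ := (hM2 n).integrable one_le_two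
    rw [eLpNorm_one_eq_lintegral_enorm, ← ofReal_integral_norm_eq_lintegral_enorm hi]
    refine ENNReal.ofReal_le_ofReal ?_
    calc ∫ ω, ‖M n ω‖ ∂μ ≤ ∫ ω, (1 + M n ω ^ 2) ∂μ := by
          refine integral_mono hi.norm ((integrable_const _).add (hM2 n).integrable_sq) fun ω => ?_
          simp only [Real.norm_eq_abs]
          nlinarith [sq_abs (M n ω), sq_nonneg (|M n ω| - 1)]
      _ = 1 + ∫ ω, M n ω ^ 2 ∂μ := by
          rw [integral_add (integrable_const _) (hM2 n).integrable_sq]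
          simp
      _ ≤ 1 + B := by linarith [hEMB n]
  have hmart : Martingale M ℱ μ := by
    refine martingale_of_condExp_sub_eq_zero_nat (fun n => (hMF n).stronglyMeasurable)
      (fun n => (hM2 n).integrable one_le_two) fun n => ?_
    have h1 : M (n + 1) - M n = φ n * W n := by
      ext ω
      rw [hMsucc]
      simp
    rw [h1]
    have hWi : Integrable (W n) μ := (hW2 n).integrable one_le_two
    have h2 := condExp_mul_of_stronglyMeasurable_left (m := ℱ n) (hφ n).stronglyMeasurable
      ((hprod n).integrable one_le_two) hWi
    have h3 := condExp_indep_eq (m₁ := MeasurableSpace.comap (W n) inferInstance)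
      (measurable_iff_comap_le.1 (hWm n)) (ℱ.le n)
      (comap_measurable (W n)).stronglyMeasurable (hind n).symm
    filter_upwards [h2, h3] with ω h2 h3
    rw [h2, Pi.mul_apply, h3, hmean n, mul_zero, Pi.zero_apply]
  exact hmart.submartingale.exists_ae_tendsto_of_bdd hL1

/-- If `φ` is adapted with `∑_{i<n} φ_i² = O(n)` and `W_i` is a standardized noise independent of
`ℱ_i`, then `∑_{i<n} φ_i W_i = o(n)` almost surely. -/
theorem tendsto_avg_mul_noise (ℱ : Filtration ℕ m0) (φ W : ℕ → Ω → ℝ)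
    (hφ : ∀ i, Measurable[ℱ i] (φ i)) (hW : ∀ i, Measurable[ℱ (i + 1)] (W i))
    (hind : ∀ i, Indep (ℱ i) (MeasurableSpace.comap (W i) inferInstance) μ)
    (hW2 : ∀ i, MemLp (W i) 2 μ) (hmean : ∀ i, ∫ ω, W i ω ∂μ = 0)
    (hvar : ∀ i, ∫ ω, W i ω ^ 2 ∂μ = 1)
    (hO : ∀ᵐ ω ∂μ, ∃ K : ℝ, ∀ n : ℕ, ∑ i ∈ Finset.range n, φ i ω ^ 2 ≤ K * n) :
    ∀ᵐ ω ∂μ, Tendsto (fun n : ℕ => (∑ i ∈ Finset.range n, φ i ω * W i ω) / n) atTop (𝓝 0) := by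
  classical
  -- The growth constant is random, so localize: G K i says that constant K has sufficed up to time
  -- i. It belongs to ℱ_i, so truncating φ by it keeps φ adapted; on a path whose constant is at
  -- most K nothing is truncated.
  set G : ℕ → ℕ → Set Ω := fun K i =>
    {ω | ∀ j ≤ i, ∑ k ∈ Finset.range (j + 1), φ k ω ^ 2 ≤ K * ((j : ℝ) + 1)} with hG
  have hGm : ∀ K i, MeasurableSet[ℱ i] (G K i) := by
    intro K i
    have : G K i = ⋂ j ∈ Set.Iic i,
        {ω | ∑ k ∈ Finset.range (j + 1), φ k ω ^ 2 ≤ K * ((j : ℝ) + 1)} := by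
      ext ω
      simp [hG]
    rw [this]
    refine MeasurableSet.biInter (Set.to_countable _) fun j hj => ?_
    refine measurableSet_le (Finset.measurable_sum _ fun k hk => ?_) measurable_const
    have hk' : k ≤ i := (Nat.lt_succ_iff.1 (Finset.mem_range.1 hk)).trans hj
    exact ((hφ k).mono (ℱ.mono hk') le_rfl).pow_const 2
  set χ : ℕ → ℕ → Ω → ℝ := fun K i => (G K i).indicator (φ i) with hχ
  -- The events G K i decrease in i: after the first violation all terms vanish and the sum stays
  -- frozen.
  have hT : ∀ (K : ℕ) ω (n : ℕ), ∑ k ∈ Finset.range n, χ K k ω ^ 2 ≤ (K : ℝ) * n := by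
    intro K ω n
    induction n with
    | zero => simp
    | succ n ih =>
      by_cases hω : ω ∈ G K n
      · have h1 : ∀ k ∈ Finset.range (n + 1), χ K k ω ^ 2 = φ k ω ^ 2 := by
          intro k hk
          have hk' : k ≤ n := Nat.lt_succ_iff.1 (Finset.mem_range.1 hk)
          have : ω ∈ G K k := fun j hj => hω j (hj.trans hk')
          simp [hχ, Set.indicator_of_mem this]
        rw [Finset.sum_congr rfl h1]
        push_cast
        exact hω n le_rfl
      · rw [Finset.sum_range_succ]
        have : χ K n ω = 0 := by simp [hχ, Set.indicator_of_notMem hω]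
        rw [this]
        push_cast
        nlinarith [(Nat.cast_nonneg K : (0 : ℝ) ≤ K)]
  have hsummable : ∀ K : ℕ, Summable fun k : ℕ => (K : ℝ) / ((k : ℝ) + 1) ^ 2 := by
    intro K
    have h1 : Summable fun k : ℕ => 1 / ((k : ℝ)) ^ 2 := Real.summable_one_div_nat_pow.2 one_lt_two
    have h2 := ((summable_nat_add_iff 1).2 h1).mul_left (K : ℝ)
    refine h2.congr fun k => ?_
    push_cast
    ring
  have hconv : ∀ᵐ ω ∂μ, ∀ K : ℕ, ∃ m, Tendsto (fun n => ∑ i ∈ Finset.range n,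
      (χ K i ω / ((i : ℝ) + 1)) * W i ω) atTop (𝓝 m) := by
    rw [ae_all_iff]
    intro K
    refine exists_tendsto_sum_mul_of_bdd ℱ (fun i ω => χ K i ω / ((i : ℝ) + 1)) W
      (fun i => ((hφ i).indicator (hGm K i)).div_const _) hW hind hW2 hmean hvar ?_
      (B := ∑' k : ℕ, (K : ℝ) / ((k : ℝ) + 1) ^ 2) ?_
    · intro i
      refine ⟨Real.sqrt (K * ((i + 1 : ℕ) : ℝ)), fun ω => ?_⟩
      have h1 := hT K ω (i + 1)
      rw [Finset.sum_range_succ] at h1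
      have h2 : 0 ≤ ∑ k ∈ Finset.range i, χ K k ω ^ 2 := Finset.sum_nonneg fun _ _ => sq_nonneg _
      rw [abs_div, abs_of_pos (by positivity : (0 : ℝ) < (i : ℝ) + 1)]
      refine (div_le_self (abs_nonneg _) (by linarith [(Nat.cast_nonneg i : (0 : ℝ) ≤ i)])).trans ?_
      exact Real.abs_le_sqrt (by linarith)
    · intro n ω
      simp only [div_pow]
      refine (weighted_sum_le (hT K ω) n).trans ?_
      exact (hsummable K).sum_le_tsum _ fun k _ => by positivity
  filter_upwards [hconv, hO] with ω hω ⟨K, hK⟩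
  obtain ⟨N, hN⟩ := exists_nat_ge K
  obtain ⟨m, hm⟩ := hω N
  refine tendsto_avg_of_tendsto_sum_div (m := m) (hm.congr fun n => ?_)
  refine Finset.sum_congr rfl fun i _ => ?_
  have : ω ∈ G N i := by
    intro j _
    refine (hK (j + 1)).trans ?_
    push_cast
    gcongr
  simp only [hχ, Set.indicator_of_mem this]
  ring

end MartingaleLLN

/-! ### Quantization error, output energy and the regression identity -/

section Signals

theorem abs_quantize_sub_le {ε : ℝ} (hε : 0 < ε) (y : ℝ) : |quantize ε y - y| ≤ ε / 2 := by
  have h1 := Int.floor_le (y / ε + 1 / 2)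
  have h2 := Int.lt_floor_add_one (y / ε + 1 / 2)
  have h3 : quantize ε y - y = ε * ((⌊y / ε + 1 / 2⌋ : ℝ) - y / ε) := by
    unfold quantize
    field_simp
  rw [h3, abs_mul, abs_of_pos hε, div_eq_mul_one_div ε 2]
  refine mul_le_mul_of_nonneg_left ?_ hε.le
  rw [abs_le]
  constructor <;> linarith

theorem delay_succ_succ (x : ℕ → ℝ) (n k : ℕ) : delay x (n + 1) (k + 1) = delay x n k := by
  simp [delay]

theorem sum_delay_sq_le (x : ℕ → ℝ) (k n : ℕ) :
    ∑ i ∈ Finset.range n, delay x i k ^ 2 ≤ ∑ i ∈ Finset.range n, x i ^ 2 := by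
  induction k with
  | zero => simp [delay]
  | succ k ih =>
    refine le_trans ?_ ih
    cases n with
    | zero => simp
    | succ n =>
      rw [Finset.sum_range_succ', Finset.sum_range_succ]
      simp only [delay_succ_succ]
      have : delay x 0 (k + 1) = 0 := by simp [delay]
      rw [this]
      nlinarith [sq_nonneg (delay x n k)]

theorem sum_Icc_eq_sum_range (f : ℕ → ℝ) (m : ℕ) :
    ∑ j ∈ Finset.Icc 1 m, f j = ∑ k ∈ Finset.range m, f (k + 1) := by
  have : Finset.Icc 1 m = Finset.Ico (0 + 1) (m + 1)  := by ext i; simp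
  rw [this, ← Finset.sum_Ico_add' f 0 m 1, Finset.range_eq_Ico]

theorem sum_range_succ_sq_le {u : ℕ → ℝ} {δ : ℝ} (hu : ∀ n, |u (n + 1)| ≤ δ) (n : ℕ) :
    ∑ i ∈ Finset.range n, u i ^ 2 ≤ u 0 ^ 2 + δ ^ 2 * n := by
  have hsq : ∀ i, u (i + 1) ^ 2 ≤ δ ^ 2 := fun i => sq_le_sq' (abs_le.1 (hu i)).1 (abs_le.1 (hu i)).2
  calc ∑ i ∈ Finset.range n, u i ^ 2 ≤ ∑ i ∈ Finset.range (n + 1), u i ^ 2 := by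
        rw [Finset.sum_range_succ]
        nlinarith [sq_nonneg (u n)]
    _ = ∑ i ∈ Finset.range n, u (i + 1) ^ 2 + u 0 ^ 2 := Finset.sum_range_succ' _ _
    _ ≤ ∑ i ∈ Finset.range n, δ ^ 2 + u 0 ^ 2 := by
        exact add_le_add_left (Finset.sum_le_sum fun i _ => hsq i) _
    _ = u 0 ^ 2 + δ ^ 2 * n := by simp; ring

/-- Energy of the quantized output of a stable system with inputs bounded by `δ`. -/
theorem exists_output_energy_bound (p₀ q₀ : ℕ) (a b : ℕ → ℝ) (ha_zero : a 0 = 1)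
    (hstable : ∀ z : ℂ, ‖z‖ ≤ 1 → ∑ i ∈ Finset.range (p₀ + 1), (a i : ℂ) * z ^ i ≠ 0)
    (δ : ℝ) {ε : ℝ} (hε : 0 < ε) :
    ∃ C : ℝ, 0 ≤ C ∧ ∀ y u w : ℕ → ℝ, IsTrajectory p₀ q₀ a b y u w → (∀ n, |u (n + 1)| ≤ δ) →
      ∀ n : ℕ, ∑ i ∈ Finset.range n, quantizedOutput ε y i ^ 2
        ≤ C * (y 0 ^ 2 + u 0 ^ 2 + n + ∑ i ∈ Finset.range n, w (i + 1) ^ 2) := by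
  obtain ⟨K, hK, H⟩ := exists_energy_bound p₀ a ha_zero hstable
  set β := ∑ k ∈ Finset.range q₀, b (k + 1) ^ 2 with hβ
  have hβ0 : 0 ≤ β := Finset.sum_nonneg fun _ _ => sq_nonneg _
  set D := 2 * β * q₀ with hD
  have hD0 : 0 ≤ D := by positivity
  refine ⟨2 * K * (1 + D + D * δ ^ 2 + 2) + ε ^ 2, by positivity, fun y u w htraj hu n => ?_⟩
  -- The arbitrary initial output enters as forcing at time 0.
  set v : ℕ → ℝ := fun m => if m = 0 then y 0 else
    ∑ j ∈ Finset.Icc 1 q₀, b j * delay u m j + w m with hv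
  have hy := H y v (by simp [hv]) (fun n => by simpa [hv] using htraj n) n
  set Sw := ∑ i ∈ Finset.range n, w (i + 1) ^ 2 with hSw
  have hSw0 : 0 ≤ Sw := Finset.sum_nonneg fun _ _ => sq_nonneg _
  have hv1 : ∀ i, v (i + 1) ^ 2
      ≤ 2 * β * ∑ k ∈ Finset.range q₀, delay u i k ^ 2 + 2 * w (i + 1) ^ 2 := by
    intro i
    have h1 : v (i + 1) = ∑ k ∈ Finset.range q₀, b (k + 1) * delay u i k + w (i + 1) := by
      simp only [hv, sum_Icc_eq_sum_range, delay_succ_succ]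
      simp
    have h2 := Finset.sum_mul_sq_le_sq_mul_sq (Finset.range q₀) (fun k => b (k + 1))
      (fun k => delay u i k)
    rw [h1]
    nlinarith [sq_nonneg (∑ k ∈ Finset.range q₀, b (k + 1) * delay u i k - w (i + 1))]
  have hvs : ∑ i ∈ Finset.range n, v i ^ 2
      ≤ y 0 ^ 2 + D * (u 0 ^ 2 + δ ^ 2 * n) + 2 * Sw := by
    calc ∑ i ∈ Finset.range n, v i ^ 2 ≤ ∑ i ∈ Finset.range (n + 1), v i ^ 2 := by
          rw [Finset.sum_range_succ]
          nlinarith [sq_nonneg (v n)]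
      _ = ∑ i ∈ Finset.range n, v (i + 1) ^ 2 + y 0 ^ 2 := by
          rw [Finset.sum_range_succ']
          simp [hv]
      _ ≤ ∑ i ∈ Finset.range n,
            (2 * β * ∑ k ∈ Finset.range q₀, delay u i k ^ 2 + 2 * w (i + 1) ^ 2) + y 0 ^ 2 := by
          gcongr with i _
          exact hv1 i
      _ = 2 * β * ∑ k ∈ Finset.range q₀, ∑ i ∈ Finset.range n, delay u i k ^ 2
            + 2 * Sw + y 0 ^ 2 := by
          rw [Finset.sum_add_distrib, ← Finset.mul_sum, ← Finset.mul_sum, Finset.sum_comm]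
      _ ≤ 2 * β * ∑ k ∈ Finset.range q₀, (u 0 ^ 2 + δ ^ 2 * n) + 2 * Sw + y 0 ^ 2 := by
          gcongr with k _
          exact (sum_delay_sq_le u k n).trans (sum_range_succ_sq_le hu n)
      _ = y 0 ^ 2 + D * (u 0 ^ 2 + δ ^ 2 * n) + 2 * Sw := by
          simp only [Finset.sum_const, Finset.card_range, nsmul_eq_mul, hD]
          ring
  have hs : ∀ i, quantizedOutput ε y i ^ 2 ≤ 2 * y i ^ 2 + ε ^ 2 := by
    intro i
    by_cases hi : i = 0
    · simp only [quantizedOutput, fromOne, hi, if_true]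
      nlinarith [sq_nonneg (y 0), sq_nonneg ε]
    · simp only [quantizedOutput, fromOne, hi, if_false]
      have h1 := abs_le.1 (abs_quantize_sub_le hε (y i))
      have h2 : (quantize ε (y i) - y i) ^ 2 ≤ (ε / 2) ^ 2 := sq_le_sq' h1.1 h1.2
      nlinarith [sq_nonneg (quantize ε (y i) - 2 * y i), sq_nonneg ε]
  have hsum : ∑ i ∈ Finset.range n, quantizedOutput ε y i ^ 2
      ≤ 2 * ∑ i ∈ Finset.range n, y i ^ 2 + ε ^ 2 * n := by
    calc _ ≤ ∑ i ∈ Finset.range n, (2 * y i ^ 2 + ε ^ 2) := Finset.sum_le_sum fun i _ => hs i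
      _ = _ := by
        rw [Finset.sum_add_distrib, ← Finset.mul_sum]
        simp
        ring
  set T := y 0 ^ 2 + u 0 ^ 2 + (n : ℝ) + Sw with hT
  have hn0 : (0 : ℝ) ≤ n := Nat.cast_nonneg n
  have hy0 := sq_nonneg (y 0)
  have hu0 := sq_nonneg (u 0)
  have hT1 : y 0 ^ 2 ≤ T := by linarith
  have hT2 : u 0 ^ 2 ≤ T := by linarith
  have hT3 : (n : ℝ) ≤ T := by linarith
  have hT4 : Sw ≤ T := by linarith
  calc _ ≤ 2 * (K * (y 0 ^ 2 + D * (u 0 ^ 2 + δ ^ 2 * n) + 2 * Sw)) + ε ^ 2 * n := by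
        refine hsum.trans ?_
        gcongr
        exact hy.trans (by gcongr)
    _ ≤ 2 * (K * (T + D * (T + δ ^ 2 * T) + 2 * T)) + ε ^ 2 * T := by gcongr
    _ = _ := by ring

/-- The equation error of the quantized data apart from the noise. -/
def modelError (p₀ q₀ : ℕ) (a b s u w : ℕ → ℝ) (i : ℕ) : ℝ :=
  s (i + 1) + ∑ j ∈ Finset.Icc 1 p₀, a j * delay s (i + 1) j
    - ∑ j ∈ Finset.Icc 1 q₀, b j * delay u (i + 1) j - w (i + 1)

/-- Subtracting the true recursion leaves the rounding errors of y_{i+1} and its p₀ lags, each at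
most ε/2. For i ≥ p₀ + q₀ no lag reaches time 0, where the data are zeroed but y and u are
arbitrary. -/
theorem abs_modelError_le {p₀ q₀ : ℕ} {a b y u w : ℕ → ℝ} (h : IsTrajectory p₀ q₀ a b y u w)
    {c ε : ℝ} (hε : 0 < ε) (hac : ∀ i ∈ Finset.Icc 1 p₀, |a i| ≤ c) {i : ℕ} (hi : p₀ + q₀ ≤ i) :
    |modelError p₀ q₀ a b (quantizedOutput ε y) (fromOne u) w i| ≤ (1 + p₀ * c) * ε / 2 := by
  have hu : ∑ j ∈ Finset.Icc 1 q₀, b j * delay (fromOne u) (i + 1) j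
      = ∑ j ∈ Finset.Icc 1 q₀, b j * delay u (i + 1) j := by
    refine Finset.sum_congr rfl fun j hj => ?_
    have := Finset.mem_Icc.1 hj
    have h1 : j ≤ i + 1 := by omega
    have h2 : i + 1 - j ≠ 0 := by omega
    simp [delay, fromOne, h1, h2]
  have hs : ∀ j ≤ p₀, delay (quantizedOutput ε y) (i + 1) j = quantize ε (delay y (i + 1) j) := by
    intro j hj
    have h1 : j ≤ i + 1 := by omega
    have h2 : i + 1 - j ≠ 0 := by omega
    simp [delay, quantizedOutput, fromOne, h1, h2]
  have hss : ∑ j ∈ Finset.Icc 1 p₀, a j * delay (quantizedOutput ε y) (i + 1) j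
      = ∑ j ∈ Finset.Icc 1 p₀, a j * quantize ε (delay y (i + 1) j) :=
    Finset.sum_congr rfl fun j hj => by rw [hs j (Finset.mem_Icc.1 hj).2]
  have hs0 : quantizedOutput ε y (i + 1) = quantize ε (y (i + 1)) := by
    simp [quantizedOutput, fromOne]
  have heq : modelError p₀ q₀ a b (quantizedOutput ε y) (fromOne u) w i
      = (quantize ε (y (i + 1)) - y (i + 1))
        + ∑ j ∈ Finset.Icc 1 p₀, a j * (quantize ε (delay y (i + 1) j) - delay y (i + 1) j) := by
    have := h i
    simp only [mul_sub, Finset.sum_sub_distrib]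
    rw [modelError, hu, hss, hs0]
    linarith
  rw [heq]
  calc _ ≤ |quantize ε (y (i + 1)) - y (i + 1)| + ∑ j ∈ Finset.Icc 1 p₀,
          |a j * (quantize ε (delay y (i + 1) j) - delay y (i + 1) j)| :=
        (abs_add_le _ _).trans (by gcongr; exact Finset.abs_sum_le_sum_abs _ _)
    _ ≤ ε / 2 + ∑ j ∈ Finset.Icc 1 p₀, c * (ε / 2) := by
        gcongr with j hj
        · exact abs_quantize_sub_le hε _
        · rw [abs_mul]
          exact mul_le_mul (hac j hj) (abs_quantize_sub_le hε _) (abs_nonneg _)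
            ((abs_nonneg _).trans (hac j hj))
    _ = (1 + p₀ * c) * ε / 2 := by
        simp
        ring

theorem sum_fin_eq_sum_range {f g : ℕ → ℝ} {m p : ℕ} (hmp : m ≤ p) (hf : ∀ i, m < i → f i = 0) :
    ∑ k : Fin p, f (k + 1) * g k = ∑ k ∈ Finset.range m, f (k + 1) * g k := by
  rw [Fin.sum_univ_eq_sum_range fun k => f (k + 1) * g k]
  refine (Finset.sum_subset (Finset.range_mono hmp) fun k _ hk => ?_).symm
  rw [hf (k + 1) (by simp at hk; omega), zero_mul]

theorem eq_trueParam_dotProduct_add {p₀ q₀ p q : ℕ} {a b : ℕ → ℝ} (s u w : ℕ → ℝ)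
    (ha_gt : ∀ i, p₀ < i → a i = 0) (hb_gt : ∀ j, q₀ < j → b j = 0)
    (hp : p₀ ≤ p) (hq : q₀ ≤ q) (i : ℕ) :
    s (i + 1) = trueParam a b p q ⬝ᵥ regressor s u p q i
      + (w (i + 1) + modelError p₀ q₀ a b s u w i) := by
  have h1 : trueParam a b p q ⬝ᵥ regressor s u p q i
      = -∑ k ∈ Finset.range p₀, a (k + 1) * delay s i k
        + ∑ k ∈ Finset.range q₀, b (k + 1) * delay u i k := by
    rw [← sum_fin_eq_sum_range (g := fun k => delay s i k) hp ha_gt,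
      ← sum_fin_eq_sum_range (g := fun k => delay u i k) hq hb_gt]
    simp [trueParam, regressor, dotProduct]
  rw [h1, modelError, sum_Icc_eq_sum_range, sum_Icc_eq_sum_range]
  simp only [delay_succ_succ]
  ring

theorem sum_dite_lt {p m : ℕ} (hpm : p ≤ m) (F : Fin p → ℝ) :
    (∑ i : Fin m, if h : (i : ℕ) < p then F ⟨i, h⟩ else 0) = ∑ j : Fin p, F j := by
  obtain ⟨k, rfl⟩ := Nat.exists_eq_add_of_le hpm
  rw [Fin.sum_univ_add]
  simp

/-- Padding leaves predictions unchanged, so a model of too low order can be treated as one of order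
p₀. -/
theorem paddedEstimate_dotProduct {p₀ p : ℕ} (hp : p ≤ p₀) (s u : ℕ → ℝ) (q n i : ℕ) :
    paddedEstimate s u p₀ p q n ⬝ᵥ regressor s u p₀ q i
      = lsEstimate s u p q n ⬝ᵥ regressor s u p q i := by
  simp only [dotProduct, Fintype.sum_sum_type, paddedEstimate, regressor, Sum.elim_inl,
    Sum.elim_inr, dite_mul, zero_mul]
  congr 1
  exact sum_dite_lt hp fun j => lsEstimate s u p q n (Sum.inl j) * delay s i j

theorem paddedEstimate_dotProduct_self {p₀ p : ℕ} (hp : p ≤ p₀) (s u : ℕ → ℝ) (q n : ℕ) :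
    paddedEstimate s u p₀ p q n ⬝ᵥ paddedEstimate s u p₀ p q n
      = lsEstimate s u p q n ⬝ᵥ lsEstimate s u p q n := by
  simp only [dotProduct, Fintype.sum_sum_type, paddedEstimate, Sum.elim_inl, Sum.elim_inr]
  congr 1
  rw [← sum_dite_lt hp fun j => lsEstimate s u p q n (Sum.inl j) * lsEstimate s u p q n (Sum.inl j)]
  refine Finset.sum_congr rfl fun i _ => ?_
  split_ifs <;> simp

theorem paramError_sq (a b s u : ℕ → ℝ) (p₀ p q n : ℕ) :
    paramError a b s u p₀ p q n ^ 2
      = (trueParam a b p₀ q - paddedEstimate s u p₀ p q n)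
        ⬝ᵥ (trueParam a b p₀ q - paddedEstimate s u p₀ p q n) := by
  rw [paramError, EuclideanSpace.real_norm_sq_eq]
  simp only [dotProduct, sq]

/-- For p < p₀ the last AR entry of the padded estimate is 0, so the error there is −a_{p₀}. -/
theorem sq_le_paramError_sq {a b s u : ℕ → ℝ} {p₀ p q n : ℕ} (hp : p < p₀) :
    a p₀ ^ 2 ≤ paramError a b s u p₀ p q n ^ 2 := by
  rw [paramError_sq]
  set d := trueParam a b p₀ q - paddedEstimate s u p₀ p q n with hd
  have hlt : p₀ - 1 < p₀ := by omega
  have h1 : d (Sum.inl ⟨p₀ - 1, hlt⟩) = -a p₀ := by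
    have h2 : p₀ - 1 + 1 = p₀ := by omega
    have h3 : ¬ p₀ - 1 < p := by omega
    simp [hd, trueParam, paddedEstimate, h2, h3]
  have h4 := Finset.single_le_sum (f := fun k => d k * d k) (fun k _ => mul_self_nonneg (d k))
    (Finset.mem_univ (Sum.inl ⟨p₀ - 1, hlt⟩))
  simp only [h1] at h4
  rw [dotProduct]
  linarith [h4]

theorem infoMatrix_eq_gram (s u : ℕ → ℝ) (p q n : ℕ) :
    infoMatrix s u p q n = gram (regressor s u p q) n := rfl

theorem lsEstimate_eq_ridge (s u : ℕ → ℝ) (p q n : ℕ) :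
    lsEstimate s u p q n = ridge (regressor s u p q) (fun i => s (i + 1)) n := rfl

/-- The form is at most one plus the trace ∑|ψ_i|², in which each signal's energy is counted at most
once per lag. -/
theorem lambdaMax_le (s u : ℕ → ℝ) (p q n : ℕ) :
    lambdaMax s u p q n ≤ 1 + (p * ∑ i ∈ Finset.range (n + 1), s i ^ 2
      + q * ∑ i ∈ Finset.range (n + 1), u i ^ 2) := by
  have hψ : ∑ i ∈ Finset.range (n + 1), regressor s u p q i ⬝ᵥ regressor s u p q i
      ≤ p * ∑ i ∈ Finset.range (n + 1), s i ^ 2 + q * ∑ i ∈ Finset.range (n + 1), u i ^ 2 := by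
    simp only [dotProduct, Fintype.sum_sum_type, regressor, Sum.elim_inl, Sum.elim_inr, ← sq]
    rw [Finset.sum_add_distrib, Finset.sum_comm,
      Finset.sum_comm (s := Finset.range (n + 1)) (t := (Finset.univ : Finset (Fin q)))]
    refine add_le_add ?_ ?_
    · refine (Finset.sum_le_sum fun (k : Fin p) _ => sum_delay_sq_le s k (n + 1)).trans_eq ?_
      simp
    · refine (Finset.sum_le_sum fun (k : Fin q) _ => sum_delay_sq_le u k (n + 1)).trans_eq ?_
      simp
  rw [lambdaMax, infoMatrix_eq_gram]
  refine sSup_spectrum_le (by positivity) fun x => ?_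
  refine (gram_quadForm_le _ _ _).trans ?_
  gcongr
  exact dotProduct_self_nonneg' x

end Signals

/-! ### Linear-rate comparison of residuals and separation of the orders -/

section Asymptotics

theorem eventually_le_mul_nat {α : ℝ} (hα : 0 < α) (R : ℝ) : ∀ᶠ n : ℕ in atTop, R ≤ α * n :=
  (tendsto_natCast_atTop_atTop.const_mul_atTop hα).eventually_ge_atTop R

theorem eventually_sum_range_le {f : ℕ → ℝ} {D α : ℝ} (hD : 0 ≤ D) (hα : 0 < α) {N : ℕ}
    (hf : ∀ i, N ≤ i → f i ≤ D) :
    ∀ᶠ n : ℕ in atTop, ∑ i ∈ Finset.range n, f i ≤ (D + α) * n := by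
  filter_upwards [eventually_le_mul_nat hα (∑ i ∈ Finset.range N, f i), eventually_ge_atTop N]
    with n hn hNn
  rw [← Finset.sum_range_add_sum_Ico _ hNn]
  have h1 : ∑ i ∈ Finset.Ico N n, f i ≤ ∑ i ∈ Finset.Ico N n, D :=
    Finset.sum_le_sum fun i hi => hf i (Finset.mem_Ico.1 hi).1
  have h2 : ∑ i ∈ Finset.Ico N n, D ≤ D * n := by
    rw [Finset.sum_const, Nat.card_Ico, nsmul_eq_mul, mul_comm]
    gcongr
    exact Nat.sub_le _ _
  linarith

/-- d_n may depend on the whole path, so dᵀψ_i is not adapted. Expanding in coordinates gives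
finitely many products of a bounded sequence with a null one. -/
theorem eventually_abs_sum_dotProduct_le {ι : Type*} [Fintype ι] {ψ : ℕ → ι → ℝ} {w : ℕ → ℝ}
    (h : ∀ k, Tendsto (fun n : ℕ => (∑ i ∈ Finset.range n, ψ i k * w i) / n) atTop (𝓝 0))
    {d : ℕ → ι → ℝ} {R : ℝ} (hd : ∀ᶠ n in atTop, d n ⬝ᵥ d n ≤ R) {α : ℝ} (hα : 0 < α) :
    ∀ᶠ n : ℕ in atTop, |∑ i ∈ Finset.range n, (d n ⬝ᵥ ψ i) * w i| ≤ α * n := by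
  have hk : ∀ k, Tendsto (fun n : ℕ => d n k * ((∑ i ∈ Finset.range n, ψ i k * w i) / n))
      atTop (𝓝 0) := by
    intro k
    have hb : IsBoundedUnder (· ≤ ·) atTop (norm ∘ fun n => d n k) := by
      refine ⟨Real.sqrt R, eventually_map.2 ?_⟩
      filter_upwards [hd] with n hn
      refine Real.abs_le_sqrt (le_trans ?_ hn)
      rw [sq]
      exact Finset.single_le_sum (f := fun k => d n k * d n k) (fun k _ => mul_self_nonneg _)
        (Finset.mem_univ k)
    exact isBoundedUnder_le_mul_tendsto_zero hb (h k)
  have hsum := tendsto_finsetSum Finset.univ fun k _ => hk k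
  rw [Finset.sum_const_zero] at hsum
  have hev := (tendsto_order.1 hsum.abs).2 α (by simpa using hα)
  filter_upwards [hev, eventually_gt_atTop 0] with n hn hn0
  have hn0' : (0 : ℝ) < n := by exact_mod_cast hn0
  have heq : ∑ i ∈ Finset.range n, (d n ⬝ᵥ ψ i) * w i
      = (∑ k, d n k * ((∑ i ∈ Finset.range n, ψ i k * w i) / n)) * n := by
    rw [Finset.sum_mul]
    simp only [dotProduct, Finset.sum_mul]
    rw [Finset.sum_comm]
    refine Finset.sum_congr rfl fun k _ => ?_
    rw [mul_assoc, div_mul_cancel₀ _ hn0'.ne', Finset.mul_sum]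
    exact Finset.sum_congr rfl fun i _ => by ring
  rw [heq, abs_mul, abs_of_pos hn0']
  gcongr

theorem eventually_excitation {s u : ℕ → ℝ} {p q : ℕ} {c₁ : ℝ}
    (h : ∀ᶠ n : ℕ in atTop, c₁ * ((n : ℝ) + 1) ≤ lambdaMin s u p q n) :
    ∀ᶠ n : ℕ in atTop, ∀ x : Fin p ⊕ Fin q → ℝ,
      c₁ * n * (x ⬝ᵥ x) ≤ x ⬝ᵥ Matrix.mulVec (infoMatrix s u p q n) x := by
  -- `lambdaMin` at n − 1 is the one that concerns `infoMatrix` at n.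
  filter_upwards [(tendsto_sub_atTop_nat 1).eventually h, eventually_ge_atTop 1] with n hn hn1 x
  have h1 : n - 1 + 1 = n := by omega
  have h2 : ((n - 1 : ℕ) : ℝ) + 1 = n := by exact_mod_cast h1
  rw [lambdaMin, h1, h2] at hn
  refine (mul_le_mul_of_nonneg_right hn (dotProduct_self_nonneg' x)).trans ?_
  exact sInf_spectrum_mul_le (gram_isHermitian _ _) x

theorem eventually_quadForm_le {s u : ℕ → ℝ} {p q : ℕ} {c₃ : ℝ}
    (h : ∀ᶠ n : ℕ in atTop, lambdaMax s u p q n ≤ c₃ * ((n : ℝ) + 1)) :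
    ∀ᶠ n : ℕ in atTop, ∀ x : Fin p ⊕ Fin q → ℝ,
      x ⬝ᵥ Matrix.mulVec (infoMatrix s u p q n) x ≤ c₃ * n * (x ⬝ᵥ x) := by
  filter_upwards [(tendsto_sub_atTop_nat 1).eventually h, eventually_ge_atTop 1] with n hn hn1 x
  have h1 : n - 1 + 1 = n := by omega
  have h2 : ((n - 1 : ℕ) : ℝ) + 1 = n := by exact_mod_cast h1
  rw [lambdaMax, h1, h2] at hn
  refine le_trans ?_ (mul_le_mul_of_nonneg_right hn (dotProduct_self_nonneg' x))
  exact le_sSup_spectrum_mul (gram_isHermitian _ _) x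

/-- c₁n|θ_n|² is at most the Gram form at θ_n, hence at most ∑_{i<n} s_{i+1}² ≤ C(n+1) ≤ 2Cn. -/
theorem eventually_lsEstimate_le {s u : ℕ → ℝ} {p q : ℕ} {c₁ C : ℝ} (hc₁ : 0 < c₁) (hC : 0 ≤ C)
    (hs : ∀ᶠ n : ℕ in atTop, ∑ i ∈ Finset.range n, s i ^ 2 ≤ C * n)
    (h : ∀ᶠ n : ℕ in atTop, c₁ * ((n : ℝ) + 1) ≤ lambdaMin s u p q n) :
    ∀ᶠ n : ℕ in atTop, lsEstimate s u p q n ⬝ᵥ lsEstimate s u p q n ≤ 2 * C / c₁ := by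
  filter_upwards [(tendsto_add_atTop_nat 1).eventually hs, eventually_excitation h,
    eventually_ge_atTop 1] with n h1 h2 hn1
  have hn : (1 : ℝ) ≤ n := by exact_mod_cast hn1
  have h3 := h2 (lsEstimate s u p q n)
  have h4 := ridge_quadForm_le (regressor s u p q) (fun i => s (i + 1)) n
  rw [← lsEstimate_eq_ridge, ← infoMatrix_eq_gram] at h4
  rw [Finset.sum_range_succ'] at h1
  push_cast at h1
  rw [le_div_iff₀ hc₁]
  have h5 : (lsEstimate s u p q n ⬝ᵥ lsEstimate s u p q n * c₁) * n ≤ 2 * C * n := by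
    nlinarith [sq_nonneg (s 0), mul_nonneg hC (sub_nonneg.2 hn)]
  exact le_of_mul_le_mul_right h5 (by linarith)

theorem sub_dotProduct_self_le {ι : Type*} [Fintype ι] (x z : ι → ℝ) :
    (x - z) ⬝ᵥ (x - z) ≤ 2 * (x ⬝ᵥ x) + 2 * (z ⬝ᵥ z) := by
  have := dotProduct_self_nonneg' (x + z)
  simp only [sub_dotProduct, dotProduct_sub, add_dotProduct, dotProduct_add] at this ⊢
  linarith

theorem eventually_paramError_sq_le {s u : ℕ → ℝ} {p p₀ q : ℕ} (a b : ℕ → ℝ) {c₁ C : ℝ}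
    (hp : p ≤ p₀) (hc₁ : 0 < c₁) (hC : 0 ≤ C)
    (hs : ∀ᶠ n : ℕ in atTop, ∑ i ∈ Finset.range n, s i ^ 2 ≤ C * n)
    (h : ∀ᶠ n : ℕ in atTop, c₁ * ((n : ℝ) + 1) ≤ lambdaMin s u p q n) :
    ∀ᶠ n : ℕ in atTop, paramError a b s u p₀ p q n ^ 2
      ≤ 2 * (trueParam a b p₀ q ⬝ᵥ trueParam a b p₀ q) + 2 * (2 * C / c₁) := by
  filter_upwards [eventually_lsEstimate_le hc₁ hC hs h] with n hn
  rw [paramError_sq]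
  refine (sub_dotProduct_self_le _ _).trans ?_
  rw [paddedEstimate_dotProduct_self hp]
  linarith

/-- Comparison of the residual energy of a bounded estimate error `d` with the energy of the
disturbance `w + η`. -/
theorem sum_sq_disturbance_expand {ι : Type*} [Fintype ι] (ψ : ℕ → ι → ℝ) (w η : ℕ → ℝ)
    (d : ι → ℝ) (n : ℕ) :
    ∑ i ∈ Finset.range n, (d ⬝ᵥ ψ i + (w i + η i)) ^ 2
      = ∑ i ∈ Finset.range n, (w i + η i) ^ 2 + 2 * ∑ i ∈ Finset.range n, (d ⬝ᵥ ψ i) * w i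
        + 2 * ∑ i ∈ Finset.range n, (d ⬝ᵥ ψ i) * η i + ∑ i ∈ Finset.range n, (d ⬝ᵥ ψ i) ^ 2 := by
  rw [Finset.mul_sum, Finset.mul_sum, ← Finset.sum_add_distrib, ← Finset.sum_add_distrib,
    ← Finset.sum_add_distrib]
  exact Finset.sum_congr rfl fun i _ => by ring

section Comparison

variable {p₀ q₀ p q : ℕ} {a b s u w : ℕ → ℝ}

local notation "η" => modelError p₀ q₀ a b s u w

/-- The residual at the true order is at most the disturbance energy, up to `o(n)`. -/
theorem eventually_residual_le (ha_gt : ∀ i, p₀ < i → a i = 0) (hb_gt : ∀ j, q₀ < j → b j = 0)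
    (hq : q₀ ≤ q) {α : ℝ} (hα : 0 < α) :
    ∀ᶠ n : ℕ in atTop, residual s u p₀ q n
      ≤ ∑ i ∈ Finset.range n, (w (i + 1) + η i) ^ 2 + α * n := by
  filter_upwards [eventually_le_mul_nat hα (trueParam a b p₀ q ⬝ᵥ trueParam a b p₀ q)] with n hn
  have h1 := ridge_le (regressor s u p₀ q) (fun i => s (i + 1)) n (trueParam a b p₀ q)
  rw [← lsEstimate_eq_ridge] at h1
  have h2 : ∀ i, s (i + 1) - trueParam a b p₀ q ⬝ᵥ regressor s u p₀ q i = w (i + 1) + η i := by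
    intro i
    rw [eq_trueParam_dotProduct_add s u w ha_gt hb_gt le_rfl hq i]
    ring
  simp only [h2] at h1
  rw [residual]
  linarith

/-- Overfitting lowers the residual by at most the energy of the model error, up to `o(n)`. -/
theorem eventually_le_residual_of_overfit (ha_gt : ∀ i, p₀ < i → a i = 0)
    (hb_gt : ∀ j, q₀ < j → b j = 0) (hp : p₀ ≤ p) (hq : q₀ ≤ q)
    (hnoise : ∀ k, Tendsto (fun n : ℕ =>
      (∑ i ∈ Finset.range n, regressor s u p q i k * w (i + 1)) / n) atTop (𝓝 0))
    {R : ℝ} (hθ : ∀ᶠ n in atTop, lsEstimate s u p q n ⬝ᵥ lsEstimate s u p q n ≤ R)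
    {α : ℝ} (hα : 0 < α) :
    ∀ᶠ n : ℕ in atTop, ∑ i ∈ Finset.range n, (w (i + 1) + η i) ^ 2
      - ∑ i ∈ Finset.range n, η i ^ 2 - 2 * (α * n) ≤ residual s u p q n := by
  set d : ℕ → Fin p ⊕ Fin q → ℝ := fun n => trueParam a b p q - lsEstimate s u p q n with hd
  have hdR : ∀ᶠ n in atTop,
      d n ⬝ᵥ d n ≤ 2 * (trueParam a b p q ⬝ᵥ trueParam a b p q) + 2 * R := by
    filter_upwards [hθ] with n hn
    refine (sub_dotProduct_self_le _ _).trans ?_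
    linarith
  filter_upwards [eventually_abs_sum_dotProduct_le hnoise hdR hα] with n hn
  have h1 : residual s u p q n = ∑ i ∈ Finset.range n,
      (d n ⬝ᵥ regressor s u p q i + (w (i + 1) + η i)) ^ 2 := by
    refine Finset.sum_congr rfl fun i _ => ?_
    rw [eq_trueParam_dotProduct_add s u w ha_gt hb_gt hp hq i, hd, sub_dotProduct]
    ring
  -- Completing the square in η bounds the terms in d below by −∑η², whatever the size of d.
  have h2 : 0 ≤ ∑ i ∈ Finset.range n, (d n ⬝ᵥ regressor s u p q i + η i) ^ 2 :=
    Finset.sum_nonneg fun _ _ => sq_nonneg _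
  have h3 : ∑ i ∈ Finset.range n, (d n ⬝ᵥ regressor s u p q i + η i) ^ 2
      = 2 * ∑ i ∈ Finset.range n, (d n ⬝ᵥ regressor s u p q i) * η i
        + ∑ i ∈ Finset.range n, (d n ⬝ᵥ regressor s u p q i) ^ 2
        + ∑ i ∈ Finset.range n, η i ^ 2 := by
    rw [Finset.mul_sum, ← Finset.sum_add_distrib, ← Finset.sum_add_distrib]
    exact Finset.sum_congr rfl fun i _ => by ring
  rw [h1, sum_sq_disturbance_expand]
  have h4 := (abs_le.1 hn).1
  linarith

/-- Underfitting raises the residual linearly, at a rate given by the excitation and the leading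
coefficient of `A`. -/
theorem eventually_le_residual_of_underfit (ha_gt : ∀ i, p₀ < i → a i = 0)
    (hb_gt : ∀ j, q₀ < j → b j = 0) (hp : p < p₀) (hq : q₀ ≤ q)
    (hnoise : ∀ k, Tendsto (fun n : ℕ =>
      (∑ i ∈ Finset.range n, regressor s u p₀ q i k * w (i + 1)) / n) atTop (𝓝 0))
    {c₁ c₃ γ κ : ℝ} (hc₁ : 0 < c₁) (hc₃ : 0 < c₃) (hκ : 0 ≤ κ)
    (hmin : ∀ᶠ n : ℕ in atTop, c₁ * ((n : ℝ) + 1) ≤ lambdaMin s u p₀ q n)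
    (hmax : ∀ᶠ n : ℕ in atTop, lambdaMax s u p₀ q n ≤ c₃ * ((n : ℝ) + 1))
    (herr : ∀ᶠ n : ℕ in atTop, paramError a b s u p₀ p q n ≤ γ)
    (hη : ∀ᶠ n : ℕ in atTop, ∑ i ∈ Finset.range n, η i ^ 2 ≤ κ * n)
    {α : ℝ} (hα : 0 < α) :
    ∀ᶠ n : ℕ in atTop, ∑ i ∈ Finset.range n, (w (i + 1) + η i) ^ 2
      + (a p₀ ^ 2 * c₁ - 2 * γ * Real.sqrt (c₃ * κ)) * n - 3 * (α * n) ≤ residual s u p q n := by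
  set d : ℕ → Fin p₀ ⊕ Fin q → ℝ :=
    fun n => trueParam a b p₀ q - paddedEstimate s u p₀ p q n with hd
  have hnn : ∀ n, 0 ≤ paramError a b s u p₀ p q n := fun n => norm_nonneg _
  have hdγ : ∀ᶠ n in atTop, d n ⬝ᵥ d n ≤ γ ^ 2 := by
    filter_upwards [herr] with n hn
    rw [hd, ← paramError_sq]
    exact pow_le_pow_left₀ (hnn n) hn 2
  filter_upwards [eventually_abs_sum_dotProduct_le hnoise hdγ hα, hdγ, herr, hη,
    eventually_excitation hmin, eventually_quadForm_le hmax, eventually_le_mul_nat hα (γ ^ 2)]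
    with n hn hdn hen hηn hminn hmaxn hγn
  have hγ0 : 0 ≤ γ := (hnn n).trans hen
  have hn0 : (0 : ℝ) ≤ n := Nat.cast_nonneg n
  have h1 : residual s u p q n = ∑ i ∈ Finset.range n,
      (d n ⬝ᵥ regressor s u p₀ q i + (w (i + 1) + η i)) ^ 2 := by
    refine Finset.sum_congr rfl fun i _ => ?_
    rw [eq_trueParam_dotProduct_add s u w ha_gt hb_gt le_rfl hq i, hd, sub_dotProduct,
      paddedEstimate_dotProduct hp.le]
    ring
  have hquad := gram_quadForm (regressor s u p₀ q) n (d n)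
  rw [← infoMatrix_eq_gram] at hquad
  have h2 := hminn (d n)
  have h3 := hmaxn (d n)
  have had : a p₀ ^ 2 ≤ d n ⬝ᵥ d n := by
    rw [hd, ← paramError_sq]
    exact sq_le_paramError_sq hp
  set Q := ∑ i ∈ Finset.range n, (d n ⬝ᵥ regressor s u p₀ q i) ^ 2 with hQ
  set E := ∑ i ∈ Finset.range n, η i ^ 2 with hE
  have hE0 : 0 ≤ E := Finset.sum_nonneg fun _ _ => sq_nonneg _
  have hQ0 : 0 ≤ Q := Finset.sum_nonneg fun _ _ => sq_nonneg _
  have hQup : Q ≤ c₃ * n * γ ^ 2 := by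
    have := dotProduct_self_nonneg' (d n)
    have := mul_le_mul_of_nonneg_left hdn (by positivity : 0 ≤ c₃ * n)
    linarith
  -- The identity in the Gram matrix contributes |d|² ≤ γ², which αn absorbs.
  have hQlow : a p₀ ^ 2 * c₁ * n - α * n ≤ Q := by
    have := mul_le_mul_of_nonneg_left had (by positivity : 0 ≤ c₁ * n)
    linarith
  have hcs := Finset.sum_mul_sq_le_sq_mul_sq (Finset.range n)
    (fun i => d n ⬝ᵥ regressor s u p₀ q i) (fun i => η i)
  have hcross : |∑ i ∈ Finset.range n, (d n ⬝ᵥ regressor s u p₀ q i) * η i|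
      ≤ γ * Real.sqrt (c₃ * κ) * n := by
    refine abs_le_of_sq_le_sq (hcs.trans ?_) (by positivity)
    rw [mul_pow, mul_pow, Real.sq_sqrt (by positivity)]
    calc Q * E ≤ (c₃ * n * γ ^ 2) * (κ * n) := by gcongr
      _ = _ := by ring
  rw [h1, sum_sq_disturbance_expand]
  have h4 := (abs_le.1 hn).1
  have h5 := (abs_le.1 hcross).1
  linarith

end Comparison

/-- Along a path with vanishing noise correlations, the criterion eventually separates the true
order from every other order. -/
theorem eventually_criterion_lt {p₀ q₀ q pmax p : ℕ} {a b s u w : ℕ → ℝ}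
    (ha_gt : ∀ i, p₀ < i → a i = 0) (hb_gt : ∀ j, q₀ < j → b j = 0) (hq : q₀ ≤ q)
    (hp₀ : p₀ ≤ pmax) (hp : p ≤ pmax) (hne : p ≠ p₀)
    (hnoise : ∀ p, ∀ k, Tendsto (fun n : ℕ =>
      (∑ i ∈ Finset.range n, regressor s u p q i k * w (i + 1)) / n) atTop (𝓝 0))
    {c₁ c₃ γ κ C : ℝ} (hc₁ : 0 < c₁) (hc₃ : 0 < c₃) (hκ : 0 < κ) (hC : 0 ≤ C)
    (hs : ∀ᶠ n : ℕ in atTop, ∑ i ∈ Finset.range n, s i ^ 2 ≤ C * n)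
    (hmin : ∀ p ≤ pmax, ∀ᶠ n : ℕ in atTop, c₁ * ((n : ℝ) + 1) ≤ lambdaMin s u p q n)
    (hmax : ∀ᶠ n : ℕ in atTop, lambdaMax s u p₀ q n ≤ c₃ * ((n : ℝ) + 1))
    (herr : ∀ p ≤ p₀, ∀ᶠ n : ℕ in atTop, paramError a b s u p₀ p q n ≤ γ)
    (hη : ∀ᶠ n : ℕ in atTop,
      ∑ i ∈ Finset.range n, modelError p₀ q₀ a b s u w i ^ 2 ≤ κ * n)
    {α₁ α₂ : ℝ} (hα₁ : 0 < α₁) (hα₂ : 0 < α₂) (hα₂' : α₂ < 1) {l : ℕ → ℝ}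
    (hl : ∀ n : ℕ, 1 ≤ n → (5 * κ + α₁) * n ≤ l n)
    (hl' : ∀ n : ℕ, 1 ≤ n → l n ≤ α₂ / pmax *
      (a p₀ ^ 2 * c₁ - 2 * γ * Real.sqrt (c₃ * κ) - 3 * κ) * n) :
    ∀ᶠ n : ℕ in atTop, criterion l s u p₀ q n < criterion l s u p q n := by
  rcases lt_or_gt_of_ne hne with hlt | hgt
  -- Slack: κ/8 + 3κ/8 = κ/2 per step, covered by the 3κ subtracted in the upper bound on l_n.
  · filter_upwards [eventually_residual_le (s := s) (u := u) (w := w) ha_gt hb_gt hq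
        (by positivity : 0 < κ / 8),
      eventually_le_residual_of_underfit ha_gt hb_gt hlt hq (hnoise p₀) hc₁ hc₃ hκ.le
        (hmin p₀ hp₀) hmax (herr p hlt.le) hη (by positivity : 0 < κ / 8),
      eventually_ge_atTop 1] with n h1 h2 hn1
    have hn : (1 : ℝ) ≤ n := by exact_mod_cast hn1
    have hpm : (0 : ℝ) < pmax := by exact_mod_cast (by omega : 0 < pmax)
    set Br := a p₀ ^ 2 * c₁ - 2 * γ * Real.sqrt (c₃ * κ) - 3 * κ with hBr
    have hln := hl n hn1
    have hln' := hl' n hn1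
    have hl0 : 0 ≤ l n := le_trans (by positivity) hln
    have h3 : l n * pmax ≤ α₂ * (Br * n) := by
      refine (mul_le_mul_of_nonneg_right hln' hpm.le).trans_eq ?_
      field_simp
    -- The bracket's sign is not assumed: l_n ≥ 0 forces it, and only then may α₂ be replaced by 1.
    have h4 : 0 ≤ Br * n :=
      nonneg_of_mul_nonneg_right ((mul_nonneg hl0 hpm.le).trans h3) hα₂
    have h5 : α₂ * (Br * n) ≤ Br * n := mul_le_of_le_one_left h4 hα₂'.le
    have h6 : l n * (p₀ - p : ℝ) ≤ l n * pmax := by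
      have h7 : (p₀ : ℝ) ≤ pmax := by exact_mod_cast hp₀
      have h8 : (0 : ℝ) ≤ p := Nat.cast_nonneg p
      gcongr
      linarith
    have h9 : 0 < κ * n := by positivity
    have h10 : Br * n = (a p₀ ^ 2 * c₁ - 2 * γ * Real.sqrt (c₃ * κ)) * n - 3 * (κ * n) := by
      rw [hBr]
      ring
    simp only [criterion]
    linarith
  -- Costs: κ at the true order, κ + 2κ at order p; the total 4κn is below l_n.
  · filter_upwards [eventually_residual_le (s := s) (u := u) (w := w) ha_gt hb_gt hq hκ,
      eventually_le_residual_of_overfit (w := w) ha_gt hb_gt hgt.le hq (hnoise p)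
        (eventually_lsEstimate_le hc₁ hC hs (hmin p hp)) hκ, hη,
      eventually_ge_atTop 1] with n h1 h2 hηn hn1
    have hn : (1 : ℝ) ≤ n := by exact_mod_cast hn1
    have hln := hl n hn1
    have hl0 : 0 ≤ l n := le_trans (by positivity) hln
    have h6 : l n ≤ l n * (p - p₀ : ℝ) := by
      have h7 : (p₀ : ℝ) + 1 ≤ p := by exact_mod_cast hgt
      exact le_mul_of_one_le_right hl0 (by linarith)
    have h9 : 0 < α₁ * n := by positivity
    simp only [criterion]
    linarith

/-- Along such a path every minimizer of the criterion converges to the true order. -/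
theorem tendsto_argmin_criterion {p₀ q₀ q pmax : ℕ} {a b s u w : ℕ → ℝ}
    (ha_gt : ∀ i, p₀ < i → a i = 0) (hb_gt : ∀ j, q₀ < j → b j = 0) (hq : q₀ ≤ q)
    (hp₀ : p₀ ≤ pmax)
    (hnoise : ∀ p, ∀ k, Tendsto (fun n : ℕ =>
      (∑ i ∈ Finset.range n, regressor s u p q i k * w (i + 1)) / n) atTop (𝓝 0))
    {c₁ c₃ γ κ C : ℝ} (hc₁ : 0 < c₁) (hc₃ : 0 < c₃) (hκ : 0 < κ) (hC : 0 ≤ C)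
    (hs : ∀ᶠ n : ℕ in atTop, ∑ i ∈ Finset.range n, s i ^ 2 ≤ C * n)
    (hmin : ∀ p ≤ pmax, ∀ᶠ n : ℕ in atTop, c₁ * ((n : ℝ) + 1) ≤ lambdaMin s u p q n)
    (hmax : ∀ᶠ n : ℕ in atTop, lambdaMax s u p₀ q n ≤ c₃ * ((n : ℝ) + 1))
    (herr : ∀ p ≤ p₀, ∀ᶠ n : ℕ in atTop, paramError a b s u p₀ p q n ≤ γ)
    (hη : ∀ᶠ n : ℕ in atTop,
      ∑ i ∈ Finset.range n, modelError p₀ q₀ a b s u w i ^ 2 ≤ κ * n)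
    {α₁ α₂ : ℝ} (hα₁ : 0 < α₁) (hα₂ : 0 < α₂) (hα₂' : α₂ < 1) {l : ℕ → ℝ}
    (hl : ∀ n : ℕ, 1 ≤ n → (5 * κ + α₁) * n ≤ l n)
    (hl' : ∀ n : ℕ, 1 ≤ n → l n ≤ α₂ / pmax *
      (a p₀ ^ 2 * c₁ - 2 * γ * Real.sqrt (c₃ * κ) - 3 * κ) * n)
    {phat : ℕ → ℕ} (hphat : ∀ n, phat n ∈ Set.Iic pmax ∧
      IsMinOn (fun p => criterion l s u p q n) (Set.Iic pmax) (phat n)) :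
    Tendsto phat atTop (𝓝 p₀) := by
  have hsep : ∀ᶠ n : ℕ in atTop, ∀ p ∈ Finset.range (pmax + 1), p ≠ p₀ →
      criterion l s u p₀ q n < criterion l s u p q n := by
    rw [Filter.eventually_all_finset]
    intro p hp
    by_cases hne : p = p₀
    · exact Eventually.of_forall fun n h => absurd hne h
    · filter_upwards [eventually_criterion_lt ha_gt hb_gt hq hp₀
        (Nat.lt_succ_iff.1 (Finset.mem_range.1 hp)) hne hnoise hc₁ hc₃ hκ hC hs hmin hmax herr
        hη hα₁ hα₂ hα₂' hl hl'] with n hn _ using hn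
  refine tendsto_nhds_of_eventually_eq ?_
  filter_upwards [hsep] with n hn
  obtain ⟨hle, hmin⟩ := hphat n
  by_contra hne
  have h1 := hn (phat n) (Finset.mem_range.2 (Nat.lt_succ_iff.2 hle)) hne
  exact absurd (hmin (Set.mem_Iic.2 hp₀)) (not_le.2 h1)

/-- With x = (1+p₀c)ε ≤ 1/2, (x/2)² ≤ x/8 ≤ κ/8, and the transient is absorbed in κn/2. Smallness of
ε makes the bound linear in κ. -/
theorem eventually_sum_modelError_sq_le {p₀ q₀ : ℕ} {a b y u w : ℕ → ℝ}
    (h : IsTrajectory p₀ q₀ a b y u w) {c ε κ : ℝ} (hε : 0 < ε)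
    (hac : ∀ i ∈ Finset.Icc 1 p₀, |a i| ≤ c) (hκ₁ : (1 + p₀ * c) * ε ≤ 1 / 2)
    (hκ₀ : (1 + p₀ * c) * ε ≤ κ) (hκ : 0 < κ) :
    ∀ᶠ n : ℕ in atTop, ∑ i ∈ Finset.range n,
      modelError p₀ q₀ a b (quantizedOutput ε y) (fromOne u) w i ^ 2 ≤ κ * n := by
  have hle : ∀ i, p₀ + q₀ ≤ i →
      |modelError p₀ q₀ a b (quantizedOutput ε y) (fromOne u) w i| ≤ (1 + p₀ * c) * ε / 2 :=
    fun i hi => abs_modelError_le h hε hac hi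
  have hpos : 0 ≤ (1 + p₀ * c) * ε := by
    linarith [(abs_nonneg _).trans (hle _ le_rfl)]
  filter_upwards [eventually_sum_range_le
    (f := fun i => modelError p₀ q₀ a b (quantizedOutput ε y) (fromOne u) w i ^ 2)
    (sq_nonneg ((1 + p₀ * c) * ε / 2)) (half_pos hκ)
    (fun i hi => sq_le_sq' (abs_le.1 (hle i hi)).1 (abs_le.1 (hle i hi)).2)] with n hn
  refine hn.trans ?_
  gcongr
  nlinarith

end Asymptotics

/-! ### Filtration, noise moments and almost sure energy growth -/

section Probability

theorem measurable_quantize (ε : ℝ) : Measurable (quantize ε) := by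
  unfold quantize
  exact ((measurable_from_top (f := fun m : ℤ => (m : ℝ))).comp
    (Int.measurable_floor.comp ((measurable_id.div_const ε).add_const (1 / 2)))).const_mul ε

theorem measurable_delay {Ω : Type*} {m : MeasurableSpace Ω} {x : ℕ → Ω → ℝ} {n k : ℕ}
    (h : Measurable[m] (x (n - k))) :
    Measurable[m] fun ω => delay (fun j => x j ω) n k := by
  unfold delay
  split_ifs
  · exact h
  · exact measurable_const

theorem measurable_fromOne {Ω : Type*} {m : MeasurableSpace Ω} {x : ℕ → Ω → ℝ} {n : ℕ}
    (h : Measurable[m] (x n)) : Measurable[m] fun ω => fromOne (fun j => x j ω) n := by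
  unfold fromOne
  split_ifs
  · exact measurable_const
  · exact h

variable {Ω : Type*} [MeasurableSpace Ω] {μ : Measure Ω}

/-- The initial output, the inputs up to time `n` and the noise up to time `n`. -/
def past (y₀ : Ω → ℝ) (u w : ℕ → Ω → ℝ) (n : ℕ) (ω : Ω) :
    ℝ × (Fin (n + 1) → ℝ) × (Fin n → ℝ) :=
  (y₀ ω, (fun i : Fin (n + 1) => u i ω), (fun i : Fin n => w (i + 1) ω))

/-- The filtration generated by the initial output, the inputs and the noise. -/
def pastFiltration {y₀ : Ω → ℝ} {u w : ℕ → Ω → ℝ} (hy : Measurable y₀)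
    (hu : ∀ n, Measurable (u n)) (hw : ∀ n, Measurable (w n)) :
    Filtration ℕ (inferInstance : MeasurableSpace Ω) where
  seq n := MeasurableSpace.comap (past y₀ u w n) inferInstance
  mono' := by
    intro m n hmn
    have h : past y₀ u w m = (fun x : ℝ × (Fin (n + 1) → ℝ) × (Fin n → ℝ) =>
        (x.1, (fun i : Fin (m + 1) => x.2.1 (Fin.castLE (by omega) i)),
          (fun i : Fin m => x.2.2 (Fin.castLE hmn i)))) ∘ past y₀ u w n := rfl
    change MeasurableSpace.comap (past y₀ u w m) _ ≤ MeasurableSpace.comap (past y₀ u w n) _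
    rw [h, ← MeasurableSpace.comap_comp]
    refine MeasurableSpace.comap_mono (measurable_iff_comap_le.1 ?_)
    fun_prop
  le' n := measurable_iff_comap_le.1 <| hy.prodMk <|
    (measurable_pi_lambda (fun ω (i : Fin (n + 1)) => u i ω) fun i => hu i).prodMk
      (measurable_pi_lambda (fun ω (i : Fin n) => w (i + 1) ω) fun i => hw (i + 1))

section Filtration

variable {y₀ : Ω → ℝ} {u w : ℕ → Ω → ℝ} (hy : Measurable y₀)
  (hu : ∀ n, Measurable (u n)) (hw : ∀ n, Measurable (w n))

theorem measurable_past (n : ℕ) :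
    Measurable[pastFiltration hy hu hw n] (past y₀ u w n) := comap_measurable _

theorem pastFiltration_measurable_init (n : ℕ) : Measurable[pastFiltration hy hu hw n] y₀ :=
  measurable_fst.comp (measurable_past hy hu hw n)

theorem pastFiltration_measurable_input {i n : ℕ} (hi : i ≤ n) :
    Measurable[pastFiltration hy hu hw n] (u i) :=
  ((measurable_pi_apply (⟨i, by omega⟩ : Fin (n + 1))).comp
    (measurable_fst.comp measurable_snd)).comp (measurable_past hy hu hw n)

theorem pastFiltration_measurable_noise {i n : ℕ} (hi : i < n) :
    Measurable[pastFiltration hy hu hw n] (w (i + 1)) :=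
  ((measurable_pi_apply (⟨i, hi⟩ : Fin n)).comp
    (measurable_snd.comp measurable_snd)).comp (measurable_past hy hu hw n)

/-- Solve the recursion for the newest output; by strong induction, measurability of y_0 suffices.
-/
theorem pastFiltration_measurable_output {p₀ q₀ : ℕ} {a b : ℕ → ℝ} {y : ℕ → Ω → ℝ}
    (hy : Measurable (y 0))
    (hsys : ∀ ω, IsTrajectory p₀ q₀ a b (fun n => y n ω) (fun n => u n ω) (fun n => w n ω))
    (n : ℕ) : Measurable[pastFiltration hy hu hw n] (y n) := by
  induction n using Nat.strong_induction_on with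
  | _ n ih =>
    cases n with
    | zero => exact pastFiltration_measurable_init hy hu hw 0
    | succ n =>
      have heq : y (n + 1) = fun ω =>
          ∑ j ∈ Finset.Icc 1 q₀, b j * delay (fun n => u n ω) (n + 1) j + w (n + 1) ω
          - ∑ i ∈ Finset.Icc 1 p₀, a i * delay (fun n => y n ω) (n + 1) i := by
        ext ω
        have := hsys ω n
        linarith
      rw [heq]
      refine Measurable.sub (Measurable.add ?_ ?_) ?_
      · refine Finset.measurable_sum _ fun j _ => Measurable.const_mul ?_ _
        exact measurable_delay (pastFiltration_measurable_input hy hu hw (Nat.sub_le _ _))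
      · exact pastFiltration_measurable_noise hy hu hw (Nat.lt_succ_self n)
      · refine Finset.measurable_sum _ fun j hj => Measurable.const_mul ?_ _
        have hj1 := (Finset.mem_Icc.1 hj).1
        refine measurable_delay ((ih (n + 1 - j) (by omega)).mono ?_ le_rfl)
        exact (pastFiltration hy hu hw).mono (Nat.sub_le _ _)

theorem pastFiltration_measurable_regressor {p₀ q₀ : ℕ} {a b : ℕ → ℝ} {y : ℕ → Ω → ℝ}
    (hy : Measurable (y 0))
    (hsys : ∀ ω, IsTrajectory p₀ q₀ a b (fun n => y n ω) (fun n => u n ω) (fun n => w n ω))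
    (ε : ℝ) (p q n : ℕ) (k : Fin p ⊕ Fin q) :
    Measurable[pastFiltration hy hu hw n] fun ω =>
      regressor (quantizedOutput ε fun n => y n ω) (fromOne fun n => u n ω) p q n k := by
  have hmono : ∀ j, pastFiltration hy hu hw (n - j) ≤ pastFiltration hy hu hw n :=
    fun j => (pastFiltration hy hu hw).mono (Nat.sub_le _ _)
  cases k with
  | inl k =>
    refine measurable_delay (x := fun j ω => quantizedOutput ε (fun n => y n ω) j) ?_
    refine measurable_fromOne (x := fun j ω => quantize ε (y j ω)) ?_
    exact (measurable_quantize ε).comp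
      ((pastFiltration_measurable_output hu hw hy hsys _).mono (hmono _) le_rfl)
  | inr k =>
    refine measurable_delay (x := fun j ω => fromOne (fun n => u n ω) j) ?_
    exact measurable_fromOne (pastFiltration_measurable_input hy hu hw (Nat.sub_le _ _))

end Filtration

theorem memLp_of_map_eq_gaussianReal {X : Ω → ℝ} (hX : Measurable X)
    (h : μ.map X = gaussianReal 0 1) : MemLp X 2 μ := by
  have h1 : MemLp id 2 (μ.map X) := by
    rw [h]
    exact_mod_cast memLp_id_gaussianReal (μ := 0) (v := 1) 2
  exact h1.comp_of_map hX.aemeasurable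

theorem integral_of_map_eq_gaussianReal {X : Ω → ℝ} (hX : Measurable X)
    (h : μ.map X = gaussianReal 0 1) : ∫ ω, X ω ∂μ = 0 := by
  rw [← integral_map (f := fun x => x) hX.aemeasurable measurable_id.aestronglyMeasurable, h,
    integral_id_gaussianReal]

theorem integral_sq_of_map_eq_gaussianReal {X : Ω → ℝ} (hX : Measurable X)
    (h : μ.map X = gaussianReal 0 1) : ∫ ω, X ω ^ 2 ∂μ = 1 := by
  rw [← integral_map (f := fun x => x ^ 2) hX.aemeasurable
    (measurable_id.pow_const 2).aestronglyMeasurable, h]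
  have h1 := variance_eq_sub (μ := gaussianReal 0 1) (X := id)
    (by exact_mod_cast memLp_id_gaussianReal (μ := 0) (v := 1) 2)
  rw [variance_id_gaussianReal] at h1
  simpa [integral_id_gaussianReal] using h1.symm

theorem tendsto_avg_noise_sq {w : ℕ → Ω → ℝ} (hw : ∀ n, Measurable (w n))
    (hindep : iIndepFun (fun n : ℕ => w (n + 1)) μ)
    (hlaw : ∀ n : ℕ, μ.map (w (n + 1)) = gaussianReal 0 1) :
    ∀ᵐ ω ∂μ, Tendsto (fun n : ℕ => (∑ i ∈ Finset.range n, w (i + 1) ω ^ 2) / n) atTop (𝓝 1) := by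
  have h := strong_law_ae_real (μ := μ) (fun n ω => w (n + 1) ω ^ 2)
    (memLp_of_map_eq_gaussianReal (hw 1) (hlaw 0)).integrable_sq
    (fun i j hij => (hindep.indepFun hij).comp (measurable_id.pow_const 2)
      (measurable_id.pow_const 2))
    (fun i => IdentDistrib.comp (u := fun x => x ^ 2)
      ⟨(hw (i + 1)).aemeasurable, (hw (0 + 1)).aemeasurable, by rw [hlaw i, hlaw 0]⟩
      (measurable_id.pow_const 2))
  rwa [integral_sq_of_map_eq_gaussianReal (hw (0 + 1)) (hlaw 0)] at h

theorem ae_abs_le_of_isUniform {X : Ω → ℝ} (hX : Measurable X) {δ : ℝ}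
    (h : pdf.IsUniform X (Set.Icc (-δ) δ) μ volume) : ∀ᵐ ω ∂μ, |X ω| ≤ δ := by
  have h1 : ∀ᵐ x ∂(μ.map X), x ∈ Set.Icc (-δ) δ := by
    rw [h]
    exact ae_cond_mem measurableSet_Icc
  filter_upwards [ae_of_ae_map hX.aemeasurable h1] with ω hω
  exact abs_le.2 hω

theorem sum_sq_fromOne_le {u : ℕ → ℝ} {δ : ℝ} (hu : ∀ n, |u (n + 1)| ≤ δ) (n : ℕ) :
    ∑ i ∈ Finset.range n, fromOne u i ^ 2 ≤ δ ^ 2 * n := by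
  have := sum_range_succ_sq_le (u := fromOne u) (δ := δ) (fun n => by simpa [fromOne] using hu n) n
  simpa [fromOne] using this

section EnergyGrowth

variable {S w : ℕ → ℝ} {C r : ℝ}

/-- Eventually r ≤ n and ∑w² ≤ 2n, so the constant 4C is free of the initial values; deterministic
c₃ and γ need this. -/
theorem eventually_energy_le (hC : 0 ≤ C)
    (hS : ∀ n : ℕ, ∑ i ∈ Finset.range n, S i ^ 2
      ≤ C * (r + n + ∑ i ∈ Finset.range n, w (i + 1) ^ 2))
    (hw : Tendsto (fun n : ℕ => (∑ i ∈ Finset.range n, w (i + 1) ^ 2) / n) atTop (𝓝 1)) :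
    ∀ᶠ n : ℕ in atTop, ∑ i ∈ Finset.range n, S i ^ 2 ≤ 4 * C * n := by
  filter_upwards [(tendsto_order.1 hw).2 2 one_lt_two, eventually_gt_atTop 0,
    eventually_le_mul_nat one_pos r] with n h1 hn h2
  have hn' : (0 : ℝ) < n := by exact_mod_cast hn
  rw [div_lt_iff₀ hn'] at h1
  refine (hS n).trans ?_
  calc C * (r + n + ∑ i ∈ Finset.range n, w (i + 1) ^ 2) ≤ C * (1 * n + n + 2 * n) := by gcongr
    _ = 4 * C * n := by ring

/-- The martingale law needs a bound for every n, but its constant may depend on the path. -/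
theorem exists_energy_le (hC : 0 ≤ C) (hr : 0 ≤ r)
    (hS : ∀ n : ℕ, ∑ i ∈ Finset.range n, S i ^ 2
      ≤ C * (r + n + ∑ i ∈ Finset.range n, w (i + 1) ^ 2))
    (hw : Tendsto (fun n : ℕ => (∑ i ∈ Finset.range n, w (i + 1) ^ 2) / n) atTop (𝓝 1)) :
    ∃ K : ℝ, ∀ n : ℕ, ∑ i ∈ Finset.range n, S i ^ 2 ≤ K * n := by
  obtain ⟨R, hR⟩ := hw.bddAbove_range
  refine ⟨C * (r + 1 + R), fun n => ?_⟩
  rcases Nat.eq_zero_or_pos n with rfl | hn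
  · simp
  have hn' : (1 : ℝ) ≤ n := by exact_mod_cast hn
  have h1 := hR (Set.mem_range_self n)
  rw [div_le_iff₀ (by linarith)] at h1
  refine (hS n).trans ?_
  calc C * (r + n + ∑ i ∈ Finset.range n, w (i + 1) ^ 2) ≤ C * (r * n + n + R * n) := by
        gcongr
        exact le_mul_of_one_le_right hr hn'
    _ = C * (r + 1 + R) * n := by ring

end EnergyGrowth

end Probability

end QuantizedARX

/-! ### Assembly of the consistency theorem -/

theorem theorem1
    {Ω : Type*} [MeasurableSpace Ω] (μ : Measure Ω) [IsProbabilityMeasure μ]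
    -- orders, order bounds and coefficients; `a 0 = 1` is the constant term of `A`
    (p₀ q₀ pmax qmax : ℕ) (a b : ℕ → ℝ)
    (ha_zero : a 0 = 1) (ha_lead : a p₀ ≠ 0) (ha_gt : ∀ i, p₀ < i → a i = 0)
    (hb_lead : b q₀ ≠ 0) (hb_gt : ∀ j, q₀ < j → b j = 0)
    -- signals: `y 0`, `u 0` are arbitrary initial values; `w 0` plays no role
    (y u w : ℕ → Ω → ℝ)
    (hy_meas : Measurable (y 0)) (hu_meas : ∀ n, Measurable (u n)) (hw_meas : ∀ n, Measurable (w n))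
    (hsys : ∀ ω, QuantizedARX.IsTrajectory p₀ q₀ a b (fun n => y n ω) (fun n => u n ω)
      (fun n => w n ω))
    -- i.i.d. standard Gaussian noise, each `w_{n+1}` independent of present and past
    (hw_indep : iIndepFun (fun n : ℕ => w (n + 1)) μ)
    (hw_law : ∀ n : ℕ, μ.map (w (n + 1)) = gaussianReal 0 1)
    (hw_past : ∀ n : ℕ, IndepFun
      (fun ω => (y 0 ω, (fun i : Fin (n + 1) => u i ω), (fun i : Fin n => w (i + 1) ω)))
      (w (n + 1)) μ)
    -- i.i.d. uniform inputs
    (δ : ℝ) (hδ : 0 < δ)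
    (hu_indep : iIndepFun (fun n : ℕ => u (n + 1)) μ)
    (hu_law : ∀ n : ℕ, pdf.IsUniform (u (n + 1)) (Set.Icc (-δ) δ) μ volume)
    -- stability of `A(z)`
    (hstable : ∀ z : ℂ, ‖z‖ ≤ 1 → ∑ i ∈ Finset.range (p₀ + 1), (a i : ℂ) * z ^ i ≠ 0)
    -- bounded coefficients and small quantization step
    (c ε : ℝ) (hc : 0 < c) (hε : 0 < ε)
    (hac : ∀ i ∈ Finset.Icc 1 p₀, |a i| ≤ c) (hbc : ∀ j ∈ Finset.Icc 1 q₀, |b j| ≤ c)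
    (hε_small : ε < 1 / (2 * (1 + p₀ * c)))
    -- known order bounds
    (hpmax : 0 < pmax) (hqmax : 0 < qmax) (hp₀ : p₀ ≤ pmax) (hq₀ : 1 ≤ q₀) (hq₀' : q₀ ≤ qmax)
    -- the available data: quantized outputs and inputs
    (S U : Ω → ℕ → ℝ)
    (hS : S = fun ω => QuantizedARX.quantizedOutput ε (fun n => y n ω))
    (hU : U = fun ω => QuantizedARX.fromOne (fun n => u n ω))
    -- persistent excitation
    (c₁ : ℝ) (hc₁ : 0 < c₁)
    (hPE : ∀ p ≤ pmax, ∀ᵐ ω ∂μ, ∀ᶠ n : ℕ in atTop,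
      c₁ * ((n : ℝ) + 1) ≤ QuantizedARX.lambdaMin (S ω) (U ω) p qmax n) :
    (∃ c₃, QuantizedARX.IsEigenBound μ S U p₀ qmax c₃) ∧
    (∃ γ, QuantizedARX.IsErrorBound μ a b S U p₀ qmax γ) ∧
    ∀ c₃ γ : ℝ, QuantizedARX.IsEigenBound μ S U p₀ qmax c₃ →
      QuantizedARX.IsErrorBound μ a b S U p₀ qmax γ →
    ∀ (α₁ α₂ : ℝ), 0 < α₁ → 0 < α₂ → α₂ < 1 →
    ∀ l : ℕ → ℝ,
      (∀ n : ℕ, 1 ≤ n → (5 * (1 + pmax * c) * ε + α₁) * n ≤ l n) →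
      (∀ n : ℕ, 1 ≤ n → l n ≤ α₂ / pmax *
        (a p₀ ^ 2 * c₁ - 2 * γ * Real.sqrt (c₃ * (1 + pmax * c) * ε)
          - 3 * (1 + pmax * c) * ε) * n) →
    ∀ phat : ℕ → Ω → ℕ,
      (∀ n ω, phat n ω ∈ Set.Iic pmax ∧
        IsMinOn (fun p => QuantizedARX.criterion l (S ω) (U ω) p qmax n) (Set.Iic pmax)
          (phat n ω)) →
      ∀ᵐ ω ∂μ, Tendsto (fun n => phat n ω) atTop (𝓝 p₀) := by
  open QuantizedARX in
  obtain ⟨C, hC, hE⟩ := exists_output_energy_bound p₀ q₀ a b ha_zero hstable δ hε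
  have hu_bdd : ∀ᵐ ω ∂μ, ∀ n, |u (n + 1) ω| ≤ δ :=
    ae_all_iff.2 fun n => ae_abs_le_of_isUniform (hu_meas (n + 1)) (hu_law n)
  have hw_sq := tendsto_avg_noise_sq hw_meas hw_indep hw_law
  have hS_ev : ∀ᵐ ω ∂μ, ∀ᶠ n : ℕ in atTop, ∑ i ∈ Finset.range n, S ω i ^ 2 ≤ 4 * C * n := by
    filter_upwards [hu_bdd, hw_sq] with ω h1 h2
    rw [hS]
    exact eventually_energy_le hC (hE _ _ _ (hsys ω) h1) h2
  have hS_all : ∀ᵐ ω ∂μ, ∃ K : ℝ, ∀ n : ℕ, ∑ i ∈ Finset.range n, S ω i ^ 2 ≤ K * n := by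
    filter_upwards [hu_bdd, hw_sq] with ω h1 h2
    rw [hS]
    exact exists_energy_le hC (by positivity) (hE _ _ _ (hsys ω) h1) h2
  have hU_all : ∀ᵐ ω ∂μ, ∀ n : ℕ, ∑ i ∈ Finset.range n, U ω i ^ 2 ≤ δ ^ 2 * n := by
    filter_upwards [hu_bdd] with ω h1
    rw [hU]
    exact sum_sq_fromOne_le h1
  have hnoise : ∀ᵐ ω ∂μ, ∀ p, ∀ k, Tendsto (fun n : ℕ =>
      (∑ i ∈ Finset.range n, regressor (S ω) (U ω) p qmax i k * w (i + 1) ω) / n)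
      atTop (𝓝 0) := by
    refine ae_all_iff.2 fun p => ae_all_iff.2 fun k => ?_
    refine tendsto_avg_mul_noise (pastFiltration hy_meas hu_meas hw_meas)
      (fun i ω => regressor (S ω) (U ω) p qmax i k) (fun i => w (i + 1)) ?_ ?_ ?_ ?_ ?_ ?_ ?_
    · intro i
      rw [hS, hU]
      exact pastFiltration_measurable_regressor hu_meas hw_meas hy_meas hsys ε p qmax i k
    · exact fun i => pastFiltration_measurable_noise hy_meas hu_meas hw_meas (Nat.lt_succ_self i)
    · exact fun i => (IndepFun_iff_Indep _ _ _).1 (hw_past i)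
    · exact fun i => memLp_of_map_eq_gaussianReal (hw_meas _) (hw_law i)
    · exact fun i => integral_of_map_eq_gaussianReal (hw_meas _) (hw_law i)
    · exact fun i => integral_sq_of_map_eq_gaussianReal (hw_meas _) (hw_law i)
    · filter_upwards [hS_all, hU_all] with ω ⟨K, hK⟩ hUω
      cases k with
      | inl k => exact ⟨K, fun n => (sum_delay_sq_le (S ω) k n).trans (hK n)⟩
      | inr k => exact ⟨δ ^ 2, fun n => (sum_delay_sq_le (U ω) k n).trans (hUω n)⟩
  -- c₃ bounds the trace using ∑s² ≤ 4C(n+1) and ∑u² ≤ δ²(n+1); γ combines the true parameter's norm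
  -- with the bound on the estimate.
  refine ⟨⟨1 + p₀ * (4 * C) + qmax * δ ^ 2, by positivity, ?_⟩,
    ⟨Real.sqrt (2 * (trueParam a b p₀ qmax ⬝ᵥ trueParam a b p₀ qmax)
      + 2 * (2 * (4 * C) / c₁)), fun p hp => ?_⟩, ?_⟩
  · filter_upwards [hS_ev, hU_all] with ω h1 h2
    filter_upwards [(tendsto_add_atTop_nat 1).eventually h1] with n h3
    have h4 := h2 (n + 1)
    push_cast at h3 h4
    refine (lambdaMax_le _ _ _ _ _).trans ?_
    calc _ ≤ ((n : ℝ) + 1) + (p₀ * (4 * C * ((n : ℝ) + 1)) + qmax * (δ ^ 2 * ((n : ℝ) + 1))) := by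
          gcongr
          linarith [(Nat.cast_nonneg n : (0 : ℝ) ≤ n)]
      _ = _ := by ring
  · filter_upwards [hS_ev, hPE p (hp.trans hp₀)] with ω h1 h2
    filter_upwards [eventually_paramError_sq_le a b hp hc₁ (by positivity) h1 h2] with n h3
    exact Real.le_sqrt_of_sq_le h3
  · intro c₃ γ hc₃ hγ α₁ α₂ hα₁ hα₂ hα₂' l hl hl' phat hphat
    set κ := (1 + pmax * c) * ε with hκ
    have hκ0 : 0 < κ := by positivity
    have hκ₀ : (1 + p₀ * c) * ε ≤ κ := by
      have : (p₀ : ℝ) ≤ pmax := by exact_mod_cast hp₀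
      rw [hκ]
      gcongr
    have hκ₁ : (1 + p₀ * c) * ε < 1 / 2 := by
      rw [lt_div_iff₀ (by positivity)] at hε_small
      linarith
    -- The exceptional null set may depend on p; countably many are merged.
    have hγ_all : ∀ᵐ ω ∂μ, ∀ p, p ≤ p₀ →
        ∀ᶠ n : ℕ in atTop, paramError a b (S ω) (U ω) p₀ p qmax n ≤ γ := by
      refine ae_all_iff.2 fun p => ?_
      by_cases hp : p ≤ p₀
      · filter_upwards [hγ p hp] with ω h _ using h
      · exact Eventually.of_forall fun ω h => absurd h hp
    have hPE_all : ∀ᵐ ω ∂μ, ∀ p, p ≤ pmax →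
        ∀ᶠ n : ℕ in atTop, c₁ * ((n : ℝ) + 1) ≤ lambdaMin (S ω) (U ω) p qmax n := by
      refine ae_all_iff.2 fun p => ?_
      by_cases hp : p ≤ pmax
      · filter_upwards [hPE p hp] with ω h _ using h
      · exact Eventually.of_forall fun ω h => absurd h hp
    filter_upwards [hnoise, hS_ev, hγ_all, hPE_all, hc₃.2] with ω hnω hSω hγω hPEω hmaxω
    have hη : ∀ᶠ n : ℕ in atTop, ∑ i ∈ Finset.range n,
        modelError p₀ q₀ a b (S ω) (U ω) (fun n => w n ω) i ^ 2 ≤ κ * n := by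
      rw [hS, hU]
      exact eventually_sum_modelError_sq_le (hsys ω) hε hac hκ₁.le hκ₀ hκ0
    refine tendsto_argmin_criterion ha_gt hb_gt hq₀' hp₀ hnω hc₁ hc₃.1 hκ0
      (by positivity : 0 ≤ 4 * C) hSω hPEω hmaxω hγω hη hα₁ hα₂ hα₂' (l := l)
      (s := S ω) (u := U ω) (w := fun n => w n ω) (phat := fun n => phat n ω)
      (fun n hn => ?_) (fun n hn => ?_) (fun n => hphat n ω)
    · rw [hκ, ← mul_assoc]
      exact hl n hn
    · rw [hκ, ← mul_assoc, ← mul_assoc]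
      exact hl' n hn
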